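/- **Setting.** Formulas are the expressions built from the constant $1$ and from $d(x,y)$ ($x,y$ variables) by $\varphi+\psi$, $\max(\varphi,\psi)$, $\min(\varphi,\psi)$, $r\cdot\varphi$ ($r\in\mathbb R$), $\sup_x\varphi$, $\inf_x\varphi$, and the bounded quantifiers $\sup_{x\mathrel{E}y}\varphi$, $\inf_{x\mathrel{E}y}\varphi$, where $x\mathrel{E}y$ is the membership relation ("$x$ is a member of $y$"). Put $v(1)=v(d(x,y))=1$, $v(\varphi+\psi)=v(\varphi)+v(\psi)$, $v(\max(\varphi,\psi))=v(\min(\varphi,\psi))=\max(v(\varphi),v(\psi))$, $v(r\cdot\varphi)=|r|v(\varphi)$, and let quantifiers leave $v$ unchanged. A *model of $\mathsf{MSE}$* is a complete metric space $(M,d)$ with $d\le 1$ and a closed relation $E\subseteq M^2$ such that: * for all $a,b\in M$, $d(a,b)$ is the Hausdorff distance, truncated to $[0,1]$, between $\{x:x\mathrel{E}a\}$ and $\{x:x\mathrel{E}b\}$ (so it is $1$ if exactly one of the two is empty); * (excision) for every formula $\varphi(x,\bar y)$, reals $r<s$ and parameters $\bar a$ in $M$ there is $b\in M$ such that for all $c\in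 M$: if $\varphi^M(c,\bar a)\le r$ then $c\mathrel{E}b$, and if $c\mathrel{E}b$ then $\varphi^M(c,\bar a)<s$. Here $\varphi^M$ is the obvious real value of $\varphi$, where over an empty set a bounded $\sup$ of $\varphi$ is $-v(\varphi)$ and a bounded $\inf$ is $v(\varphi)$. Write $a\sqsubseteq b$ if every $E$-member of $a$ is an $E$-member of $b$, and $\mathcal P(a)=\{b\in M:b\sqsubseteq a\}$. An element $a\in M$ is *$\varepsilon$-discrete* if any two distinct members of $a$ are at distance at least $\varepsilon$, and *uniformly discrete* if it is $\varepsilon$-discrete for some $\varepsilon>0$. Ordered pairs in $M$ are $\langle x,y\rangle=\{\{\{x\},\varnothing\},\{\{y\}\}\}$, and $a\approx b$ means that some element of $M$ is the graph of a bijection from $a$ to $b$. For uniformly discrete $a$, let $|a|_a=\{c\sqsubseteq a:c\approx a\}$; for $k\sqsubseteq\mathcal P(a)$, let $\mathrm{succ}_a(k)$ be the set of all $c\sqsubseteq a$ that arise from some member of $k$ by adding exactly one element. Let $\mathbb N_a$ be the set of all $k\sqsubseteq\mathcal P(a)$ that lie in every $y\in\mathcal P(\mathcal P(\mathcal P(a)))$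 which contains $\{\varnothing\}$ and, with each member $k$, also $\mathrm{succ}_a(k)$ unless $\mathrm{succ}_a(k)=\varnothing$. The set $a$ is *(internally) finite* if $|a|_a\in\mathbb N_a$, and *(internally) infinite* otherwise. A *chain* is an element of $M$ whose members are pairwise comparable under $\sqsubseteq$. Two uniformly discrete chains are order-isomorphic if some element of $M$ is the graph of a bijection between them that preserves and reflects $\sqsubseteq$; the order type $\mathrm{otp}(a)$ is the class of all uniformly discrete chains order-isomorphic to $a$. A uniformly discrete chain $a$ is *well-ordered* if every non-empty $b\in M$ with $b\sqsubseteq a$ has a $\sqsubseteq$-least member. The *ordinals* of $M$ are the order types of uniformly discrete well-ordered chains, and for such an ordinal $\alpha$ $$s(\alpha)=\sup\{r\in(0,1]:\text{some well-ordered } r\text{-discrete chain in } M \text{ has order type } \alpha\}.$$ An ordinal is *internally finite*, i.e. a *natural number of $M$*, if it is the order type of an internally finite uniformly discrete well-ordered chain. It is *standard* if it is the order type of a uniformly discrete well-ordered chain which, for some actual natural number $n$, has exactly $n$ members. **Statement.** Let $M$ be a model of $\mathsf{MSE}$ that has no (internally) infinite uniformly discrete sets. Then $M$ has an internally finite ordinal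 $\alpha$ with $s(\alpha)<1$, and every ordinal $\alpha$ of $M$ with $s(\alpha)<1$ is a nonstandard natural number of $M$, i.e. it is internally finite and not standard. In particular, $M$ has nonstandard natural numbers. -/

import Mathlib

namespace MSE

open Set

/-! ### Real-valued formulas with bounded quantifiers -/

/-- Real-valued formulas with free variables among `x₀, …, xₙ₋₁`. A quantifier binds the variable
with index `0` of its body; the other indices are shifted by one. The bound of a bounded quantifier
is one of the variables of the surrounding formula. -/
inductive Formula : ℕ → Type
  | one {n : ℕ} : Formula n
  | dist {n : ℕ} (i j : Fin n) : Formula n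
  | add {n : ℕ} (φ ψ : Formula n) : Formula n
  | max {n : ℕ} (φ ψ : Formula n) : Formula n
  | min {n : ℕ} (φ ψ : Formula n) : Formula n
  | smul {n : ℕ} (r : ℝ) (φ : Formula n) : Formula n
  | sup {n : ℕ} (φ : Formula (n + 1)) : Formula n
  | inf {n : ℕ} (φ : Formula (n + 1)) : Formula n
  | bsup {n : ℕ} (i : Fin n) (φ : Formula (n + 1)) : Formula n
  | binf {n : ℕ} (i : Fin n) (φ : Formula (n + 1)) : Formula n

/-- The bound `v(φ)` on the absolute value of a formula, by recursion on the formula. -/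
noncomputable def Formula.v : {n : ℕ} → Formula n → ℝ
  | _, .one => 1
  | _, .dist _ _ => 1
  | _, .add φ ψ => φ.v + ψ.v
  | _, .max φ ψ => Max.max φ.v ψ.v
  | _, .min φ ψ => Max.max φ.v ψ.v
  | _, .smul r φ => |r| * φ.v
  | _, .sup φ => φ.v
  | _, .inf φ => φ.v
  | _, .bsup _ φ => φ.v
  | _, .binf _ φ => φ.v

section Structure

variable {M : Type*}

/-- The extension `{x : x ∈ a}` of `a` with respect to the membership relation `E`
(`E x a` means that `x` is a member of `a`). -/
def members (E : M → M → Prop) (a : M) : Set M := {x | E x a}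

/-- `a` is an internal subset of `b`. -/
def Sub (E : M → M → Prop) (a b : M) : Prop := ∀ c, E c a → E c b

open Classical in
/-- The value of a formula under an assignment of its free variables. Over an empty set a bounded
supremum is `-v(φ)` and a bounded infimum is `v(φ)`. -/
noncomputable def Formula.eval [MetricSpace M] (E : M → M → Prop) :
    {n : ℕ} → Formula n → (Fin n → M) → ℝ
  | _, .one, _ => 1
  | _, .dist i j, a => Dist.dist (a i) (a j)
  | _, .add φ ψ, a => φ.eval E a + ψ.eval E a
  | _, .max φ ψ, a => Max.max (φ.eval E a) (ψ.eval E a)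
  | _, .min φ ψ, a => Min.min (φ.eval E a) (ψ.eval E a)
  | _, .smul r φ, a => r * φ.eval E a
  | _, .sup φ, a => sSup (range fun b : M => φ.eval E (Fin.cons b a))
  | _, .inf φ, a => sInf (range fun b : M => φ.eval E (Fin.cons b a))
  | _, .bsup i φ, a =>
      if (members E (a i)).Nonempty then sSup ((fun c : M => φ.eval E (Fin.cons c a)) '' members E (a i))
      else -φ.v
  | _, .binf i φ, a =>
      if (members E (a i)).Nonempty then sInf ((fun c : M => φ.eval E (Fin.cons c a)) '' members E (a i))
      else φ.v

/-! ### Metric set structures and models of MSE -/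

/-- Metric set structures: a complete metric space with `[0,1]`-valued metric and a closed binary
relation such that the distance between two elements is the Hausdorff distance of their extensions,
where the Hausdorff distance is truncated at `1` (this matters only when exactly one of the two
extensions is empty; then the distance is `1`). -/
structure IsMetricSetStructure [MetricSpace M] (E : M → M → Prop) : Prop where
  complete : CompleteSpace M
  dist_le_one : ∀ a b : M, dist a b ≤ 1
  isClosed : IsClosed {p : M × M | E p.1 p.2}
  extensional : ∀ a b : M, edist a b = min 1 (Metric.hausdorffEDist (members E a) (members E b))

/-- Excision: approximate comprehension for every formula `φ(x, y₁, …, yₙ)`, all parameters and all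
reals `r < s`. -/
def Excision [MetricSpace M] (E : M → M → Prop) : Prop :=
  ∀ (n : ℕ) (φ : Formula (n + 1)) (a : Fin n → M) (r s : ℝ), r < s →
    ∃ b : M, ∀ c : M,
      (φ.eval E (Fin.cons c a) ≤ r → E c b) ∧ (E c b → φ.eval E (Fin.cons c a) < s)

/-- `(M, d, E)` is a model of MSE (metric sets with excision). -/
structure IsModel [MetricSpace M] (E : M → M → Prop) : Prop
    extends IsMetricSetStructure E where
  excision : Excision E

/-! ### Ordered pairs, bijections and internal finiteness -/

/-- `p` is the Wiener pair `⟨x, y⟩ = {{{x}, ∅}, {{y}}}`. -/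
def IsPair (E : M → M → Prop) (p x y : M) : Prop :=
  ∃ o sx sy u w : M, members E o = ∅ ∧ members E sx = {x} ∧ members E sy = {y} ∧
    members E u = {sx, o} ∧ members E w = {sy} ∧ members E p = {u, w}

/-- `⟨x, y⟩` is a member of `f`, i.e. `f(x) = y` if `f` is the graph of a function. -/
def Maps (E : M → M → Prop) (f x y : M) : Prop := ∃ p, IsPair E p x y ∧ E p f

/-- `f` is an internal subset of `a × b` that is the graph of a bijection between `a` and `b`. -/
def IsBijection (E : M → M → Prop) (f a b : M) : Prop :=
  (∀ p, E p f → ∃ x y, E x a ∧ E y b ∧ IsPair E p x y) ∧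
  (∀ x, E x a → ∃! y, E y b ∧ Maps E f x y) ∧
  (∀ y, E y b → ∃! x, E x a ∧ Maps E f x y)

/-- `a ≈ b`: some element of `M` is the graph of a bijection between `a` and `b`. -/
def Equinumerous (E : M → M → Prop) (a b : M) : Prop := ∃ f, IsBijection E f a b

/-- The class `P(a)` of internal subsets of `a`. -/
def powerClass (E : M → M → Prop) (a : M) : Set M := {b | Sub E b a}

/-- The cardinal `|b|_a`, as the class of all internal subsets of `a` that are equinumerous with
`b`. -/
def cardClass (E : M → M → Prop) (a b : M) : Set M := {c | Sub E c a ∧ Equinumerous E c b}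

/-- The class `succ_a(b)` of those internal subsets of `a` that arise from some member of `b` by
adding exactly one element. -/
def succClass (E : M → M → Prop) (a b : M) : Set M :=
  {c | Sub E c a ∧ ∃ f, E f b ∧ Sub E f c ∧ ∃! g, E g c ∧ ¬ E g f}

/-- `k` belongs to `P(P(a))`. -/
def InPow2 (E : M → M → Prop) (a k : M) : Prop := members E k ⊆ powerClass E a

/-- `y` belongs to `P(P(P(a)))`. -/
def InPow3 (E : M → M → Prop) (a y : M) : Prop := ∀ k, E k y → InPow2 E a k

/-- `y` is inductive with respect to `a`: it contains `0 = {∅}`, and with every member `k` it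
contains `succ_a(k)`, unless `succ_a(k)` is empty. -/
def IsInductive (E : M → M → Prop) (a y : M) : Prop :=
  (∃ z, E z y ∧ members E z = {x | members E x = ∅}) ∧
  ∀ k, E k y → (∃ l, E l y ∧ members E l = succClass E a k) ∨ succClass E a k = ∅

/-- The class `ℕ_a`: those members of `P(P(a))` that belong to every inductive member of
`P(P(P(a)))`. -/
def natClass (E : M → M → Prop) (a : M) : Set M :=
  {k | InPow2 E a k ∧ ∀ y, InPow3 E a y → IsInductive E a y → E k y}

/-- `a` is (internally) finite: `|a|_a` belongs to `ℕ_a`. -/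
def IsFinite (E : M → M → Prop) (a : M) : Prop :=
  ∃ k ∈ natClass E a, members E k = cardClass E a a

/-- `a` is (internally) infinite: `|a|_a` does not belong to `ℕ_a`. -/
def IsInfinite (E : M → M → Prop) (a : M) : Prop := ¬ IsFinite E a

/-! ### Discrete sets, chains and ordinals -/

/-- `a` is `ε`-discrete. -/
def IsDiscrete [MetricSpace M] (E : M → M → Prop) (ε : ℝ) (a : M) : Prop :=
  ∀ b c, E b a → E c a → b = c ∨ ε ≤ dist b c

/-- `a` is uniformly discrete. -/
def UniformlyDiscrete [MetricSpace M] (E : M → M → Prop) (a : M) : Prop :=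
  ∃ ε : ℝ, 0 < ε ∧ IsDiscrete E ε a

/-- `a` is a chain: any two of its members are comparable under inclusion. -/
def IsChain (E : M → M → Prop) (a : M) : Prop :=
  ∀ b c, E b a → E c a → Sub E b c ∨ Sub E c b

/-- The chains `a` and `b` are order-isomorphic through a bijection that is an element of `M`. -/
def OrderIso (E : M → M → Prop) (a b : M) : Prop :=
  ∃ f, IsBijection E f a b ∧
    ∀ g h g' h', E g a → E h a → Maps E f g g' → Maps E f h h' → (Sub E g h ↔ Sub E g' h')

/-- `a` is internally well-ordered by inclusion: every non-empty internal subset of `a` has a least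
member. -/
def IsWellOrdered (E : M → M → Prop) (a : M) : Prop :=
  ∀ b, Sub E b a → (members E b).Nonempty → ∃ m, E m b ∧ ∀ x, E x b → Sub E m x

/-- The order type of `a`: the class of all uniformly discrete chains order-isomorphic to `a`. -/
def otp [MetricSpace M] (E : M → M → Prop) (a : M) : Set M :=
  {b | UniformlyDiscrete E b ∧ IsChain E b ∧ OrderIso E a b}

/-- `a` is a uniformly discrete well-ordered chain with order type `α`. -/
def Represents [MetricSpace M] (E : M → M → Prop) (a : M) (α : Set M) : Prop :=
  UniformlyDiscrete E a ∧ IsChain E a ∧ IsWellOrdered E a ∧ otp E a = α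

/-- The ordinals of `M`: the order types of uniformly discrete well-ordered chains. -/
def Ord [MetricSpace M] (E : M → M → Prop) : Set (Set M) := {α | ∃ a, Represents E a α}

/-- The scale `s(α)`: the supremum of those `r` in `(0,1]` for which some `r`-discrete well-ordered
chain has order type `α`. (The restriction to `r ≤ 1` only concerns chains with at most one member,
which are `r`-discrete for every `r`.) -/
noncomputable def scale [MetricSpace M] (E : M → M → Prop) (α : Set M) : ℝ :=
  sSup {r : ℝ | 0 < r ∧ r ≤ 1 ∧ ∃ a, IsDiscrete E r a ∧ Represents E a α}

/-- `α` is the order type of an internally finite uniformly discrete well-ordered chain, i.e. `α` is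
a natural number of `M`. -/
def IsFiniteOrd [MetricSpace M] (E : M → M → Prop) (α : Set M) : Prop :=
  ∃ a, Represents E a α ∧ IsFinite E a

/-- `α` is the standard natural number `n`: the order type of a uniformly discrete well-ordered
chain with exactly `n` members. -/
def IsStandardNat [MetricSpace M] (E : M → M → Prop) (n : ℕ) (α : Set M) : Prop :=
  ∃ a, Represents E a α ∧ (members E a).encard = n

/-- `α` is a nonstandard natural number of `M`. -/
def IsNonstandardNat [MetricSpace M] (E : M → M → Prop) (α : Set M) : Prop :=
  IsFiniteOrd E α ∧ ∀ n : ℕ, ¬ IsStandardNat E n α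

end Structure

end MSE

namespace MSE

open Set

/-! ### Renaming of variables and bounds on values -/

/-! The hypothesis makes every ordinal internally finite, so two facts remain: standard ordinals
have scale at least 1, and some ordinal has scale below 1. For the first, the von Neumann numeral
with n members is a 1-discrete chain, and any two chains with n actual members are isomorphic inside
M because finite graphs are elements of M (`exists_one_discrete`, `otp_eq_of_encard`).

The second fact holds in every model, by an argument of Hartogs and Burali-Forti type: there is a
uniformly discrete well-ordered chain G to which no 3/5-discrete well-ordered chain is isomorphic.
Excision is only approximate, so every notion used has a gap: if a weak version at one scale implies
a strong version at another, formulas cut it out exactly (`Sep` with equal predicates). Inclusion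
between members of a 3/5-discrete chain has such a gap, and `exists_gapped` encloses these chains in
a set T of elements with the gap. For b ∈ y ∈ T, similarity of pointed sets ⟨y, b⟩, meaning internal
isomorphism of initial segments, is exact as well (`sep_sim_aux`), and 1/20-close pointed sets are
similar (`sim_of_dist`). Hence distinct similarity-invariant sets of pointed sets are at least 1/20
apart, and all of them form one uniformly discrete set (`exists_forall_isInv`), in which separation
and power sets are exact.

A step enlarges an invariant S by the ⟨y, b⟩ all of whose predecessors ⟨y, c⟩ lie in S. The least
set G closed under unions of steps is a well-ordered chain by Zermelo's argument
(`IsTower.isWellOrdered`), and it has a member L that the step does not enlarge. Suppose a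
3/5-discrete well-ordered chain x were isomorphic to G. Induction along x puts every ⟨x, b⟩ into L,
while induction along G keeps ⟨x, b⟩ out of the stage matched with b. Taking the b matched with L
gives a contradiction (`not_orderIso`). -/

/-- Extension of a renaming of variables under a quantifier. -/
def liftVar {n m : ℕ} (ρ : Fin n → Fin m) : Fin (n + 1) → Fin (m + 1) :=
  Fin.cons 0 fun i => (ρ i).succ

theorem cons_comp_liftVar {M : Type*} {n m : ℕ} (ρ : Fin n → Fin m) (b : M) (a : Fin m → M) :
    (Fin.cons b a : Fin (m + 1) → M) ∘ liftVar ρ = Fin.cons b (a ∘ ρ) := by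
  funext i
  refine Fin.cases ?_ (fun i => ?_) i <;> simp [liftVar]

/-- Renaming of the free variables of a formula. -/
def Formula.rename : {n m : ℕ} → (Fin n → Fin m) → Formula n → Formula m
  | _, _, _, .one => .one
  | _, _, ρ, .dist i j => .dist (ρ i) (ρ j)
  | _, _, ρ, .add φ ψ => .add (φ.rename ρ) (ψ.rename ρ)
  | _, _, ρ, .max φ ψ => .max (φ.rename ρ) (ψ.rename ρ)
  | _, _, ρ, .min φ ψ => .min (φ.rename ρ) (ψ.rename ρ)
  | _, _, ρ, .smul r φ => .smul r (φ.rename ρ)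
  | _, _, ρ, .sup φ => .sup (φ.rename (liftVar ρ))
  | _, _, ρ, .inf φ => .inf (φ.rename (liftVar ρ))
  | _, _, ρ, .bsup i φ => .bsup (ρ i) (φ.rename (liftVar ρ))
  | _, _, ρ, .binf i φ => .binf (ρ i) (φ.rename (liftVar ρ))

theorem Formula.v_rename {n : ℕ} (φ : Formula n) :
    ∀ {m : ℕ} (ρ : Fin n → Fin m), (φ.rename ρ).v = φ.v := by
  induction φ <;> intro m ρ <;> simp_all [Formula.rename, Formula.v]

section

variable {M : Type*} [MetricSpace M] {E : M → M → Prop}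

theorem Formula.eval_rename {n : ℕ} (φ : Formula n) :
    ∀ {m : ℕ} (ρ : Fin n → Fin m) (a : Fin m → M),
      (φ.rename ρ).eval E a = φ.eval E (a ∘ ρ) := by
  induction φ <;> intro m ρ a <;>
    simp_all [Formula.rename, Formula.eval, cons_comp_liftVar, Formula.v_rename]

theorem Formula.v_nonneg {n : ℕ} (φ : Formula n) : 0 ≤ φ.v := by
  induction φ <;> simp only [Formula.v] <;> positivity

/-- Boundedness gives the suprema and infima in `eval` their meaning; on unbounded sets of reals
`sSup` and `sInf` are default values. -/
theorem Formula.abs_eval_le [Nonempty M] (hd : ∀ a b : M, Dist.dist a b ≤ 1) {n : ℕ} (φ : Formula n) :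
    ∀ a : Fin n → M, |φ.eval E a| ≤ φ.v := by
  have sSup_le : ∀ (s : Set ℝ) (r : ℝ), s.Nonempty → (∀ x ∈ s, |x| ≤ r) → |sSup s| ≤ r := by
    intro s r ⟨x, hx⟩ h
    have hb : BddAbove s := ⟨r, fun y hy => (abs_le.1 (h y hy)).2⟩
    exact abs_le.2 ⟨(abs_le.1 (h x hx)).1.trans (le_csSup hb hx),
      csSup_le ⟨x, hx⟩ fun y hy => (abs_le.1 (h y hy)).2⟩
  have sInf_le : ∀ (s : Set ℝ) (r : ℝ), s.Nonempty → (∀ x ∈ s, |x| ≤ r) → |sInf s| ≤ r := by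
    intro s r ⟨x, hx⟩ h
    have hb : BddBelow s := ⟨-r, fun y hy => (abs_le.1 (h y hy)).1⟩
    exact abs_le.2 ⟨le_csInf ⟨x, hx⟩ fun y hy => (abs_le.1 (h y hy)).1,
      (csInf_le hb hx).trans (abs_le.1 (h x hx)).2⟩
  induction φ with
  | one => intro a; simp [Formula.eval, Formula.v]
  | dist i j => intro a; simpa [Formula.eval, Formula.v, abs_of_nonneg] using hd _ _
  | add φ ψ h₁ h₂ => intro a; exact (abs_add_le _ _).trans (add_le_add (h₁ a) (h₂ a))
  | max φ ψ h₁ h₂ =>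
    intro a; exact abs_max_le_max_abs_abs.trans (max_le_max (h₁ a) (h₂ a))
  | min φ ψ h₁ h₂ =>
    intro a; exact abs_min_le_max_abs_abs.trans (max_le_max (h₁ a) (h₂ a))
  | smul r φ h =>
    intro a
    simp only [Formula.eval, Formula.v, abs_mul]
    exact mul_le_mul_of_nonneg_left (h a) (abs_nonneg _)
  | sup φ h => intro a; exact sSup_le _ _ (range_nonempty _) (by rintro _ ⟨b, rfl⟩; exact h _)
  | inf φ h => intro a; exact sInf_le _ _ (range_nonempty _) (by rintro _ ⟨b, rfl⟩; exact h _)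
  | bsup i φ h =>
    intro a
    simp only [Formula.eval, Formula.v]
    split_ifs with hi
    · exact sSup_le _ _ (hi.image _) (by rintro _ ⟨b, -, rfl⟩; exact h _)
    · rw [abs_neg, abs_of_nonneg φ.v_nonneg]
  | binf i φ h =>
    intro a
    simp only [Formula.eval, Formula.v]
    split_ifs with hi
    · exact sInf_le _ _ (hi.image _) (by rintro _ ⟨b, -, rfl⟩; exact h _)
    · rw [abs_of_nonneg φ.v_nonneg]

theorem IsModel.nonempty (hM : IsModel E) : Nonempty M :=
  let ⟨b, _⟩ := hM.excision 0 .one Fin.elim0 0 1 one_pos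
  ⟨b⟩

theorem IsModel.abs_eval_le (hM : IsModel E) {n : ℕ} (φ : Formula n) (a : Fin n → M) :
    |φ.eval E a| ≤ φ.v :=
  have := hM.nonempty
  φ.abs_eval_le hM.dist_le_one a

/-! ### Separated pairs of predicates -/

/-- The assignment that interprets each variable of a formula by a variable of the context or by a
parameter. -/
def assign {n m : ℕ} (t : Fin m → Fin n ⊕ M) (v : Fin n → M) : Fin m → M :=
  fun j => Sum.elim v id (t j)

/-- On the domain `D`, some formula with parameters is `≤ 0` where `P` holds, and is `< 1` only
where `Q` holds. -/
def Sep (E : M → M → Prop) {n : ℕ} (D P Q : (Fin n → M) → Prop) : Prop :=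
  ∃ (m : ℕ) (φ : Formula m) (t : Fin m → Fin n ⊕ M), 1 ≤ φ.v ∧ ∀ v, D v →
    (P v → φ.eval E (assign t v) ≤ 0) ∧ (φ.eval E (assign t v) < 1 → Q v)

/-- Variables and parameters, as functions of the assignment. -/
class IsTerm {n : ℕ} (t : (Fin n → M) → M) : Prop where
  out : ∃ s : Fin n ⊕ M, ∀ v, t v = Sum.elim v id s

instance {n : ℕ} (i : Fin n) : IsTerm fun v : Fin n → M => v i := ⟨⟨.inl i, fun _ => rfl⟩⟩

instance {n : ℕ} (m : M) : IsTerm fun _ : Fin n → M => m := ⟨⟨.inr m, fun _ => rfl⟩⟩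

variable {n : ℕ} {D D' P Q P' Q' : (Fin n → M) → Prop}

theorem Sep.mono (h : Sep E D P Q) (h₁ : ∀ v, D v → P' v → P v) (h₂ : ∀ v, D v → Q v → Q' v) :
    Sep E D P' Q' := by
  obtain ⟨m, φ, t, hv, h⟩ := h
  exact ⟨m, φ, t, hv, fun v hD => ⟨fun hP => (h v hD).1 (h₁ v hD hP),
    fun hφ => h₂ v hD ((h v hD).2 hφ)⟩⟩

theorem Sep.dom (h : Sep E D P Q) (hD : ∀ v, D' v → D v) : Sep E D' P Q := by
  obtain ⟨m, φ, t, hv, h⟩ := h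
  exact ⟨m, φ, t, hv, fun v hv => h v (hD v hv)⟩

/-- The formula 1 - φ exchanges the conditions φ ≤ 0 and φ ≥ 1, so the two predicates change places
under negation. -/
theorem Sep.not (h : Sep E D P Q) : Sep E D (fun v => ¬ Q v) (fun v => ¬ P v) := by
  obtain ⟨m, φ, t, hv, h⟩ := h
  refine ⟨m, .add .one (.smul (-1) φ), t, ?_, fun v hD => ?_⟩
  · simp [Formula.v, φ.v_nonneg]
  · obtain ⟨h₁, h₂⟩ := h v hD
    simp only [Formula.eval]
    refine ⟨fun hQ => ?_, fun hlt hP => ?_⟩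
    · have := not_lt.1 (mt h₂ hQ)
      linarith
    · have := h₁ hP
      linarith

theorem eval_castAdd {m m' : ℕ} (φ : Formula m) (t : Fin m → Fin n ⊕ M) (t' : Fin m' → Fin n ⊕ M)
    (v : Fin n → M) :
    (φ.rename (Fin.castAdd m')).eval E (assign (Fin.append t t') v) = φ.eval E (assign t v) := by
  rw [Formula.eval_rename]
  congr 1
  funext j
  simp [assign]

theorem eval_natAdd {m m' : ℕ} (φ : Formula m') (t : Fin m → Fin n ⊕ M) (t' : Fin m' → Fin n ⊕ M)
    (v : Fin n → M) :
    (φ.rename (Fin.natAdd m)).eval E (assign (Fin.append t t') v) = φ.eval E (assign t' v) := by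
  rw [Formula.eval_rename]
  congr 1
  funext j
  simp [assign]

theorem Sep.and (h : Sep E D P Q) (h' : Sep E D P' Q') :
    Sep E D (fun v => P v ∧ P' v) (fun v => Q v ∧ Q' v) := by
  obtain ⟨m, φ, t, hv, h⟩ := h
  obtain ⟨m', φ', t', hv', h'⟩ := h'
  refine ⟨m + m', .max (φ.rename (Fin.castAdd m')) (φ'.rename (Fin.natAdd m)), Fin.append t t', ?_,
    fun v hD => ?_⟩
  · simp [Formula.v, Formula.v_rename, hv]
  · simp only [Formula.eval, eval_castAdd, eval_natAdd, max_le_iff, max_lt_iff]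
    exact ⟨fun hP => ⟨(h v hD).1 hP.1, (h' v hD).1 hP.2⟩,
      fun hl => ⟨(h v hD).2 hl.1, (h' v hD).2 hl.2⟩⟩

theorem Sep.or (h : Sep E D P Q) (h' : Sep E D P' Q') :
    Sep E D (fun v => P v ∨ P' v) (fun v => Q v ∨ Q' v) :=
  (h.not.and h'.not).not.mono (fun _ _ h => by tauto) (fun _ _ h => by tauto)

theorem Sep.imp (h : Sep E D P Q) (h' : Sep E D P' Q') :
    Sep E D (fun v => Q v → P' v) (fun v => P v → Q' v) :=
  (h.not.or h').mono (fun _ _ h => by tauto) (fun _ _ h => by tauto)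

theorem Sep.iff (h : Sep E D P P) (h' : Sep E D P' P') :
    Sep E D (fun v => P v ↔ P' v) (fun v => P v ↔ P' v) :=
  ((h.imp h').and (h'.imp h)).mono (fun _ _ h => ⟨h.1, h.2⟩) (fun _ _ h => ⟨h.1, h.2⟩)

theorem Sep.const (p : Prop) : Sep E D (fun _ => p) (fun _ => p) := by
  have hf : Sep E D (fun _ => False) (fun _ => False) :=
    ⟨0, .one, Fin.elim0, by simp [Formula.v], fun v _ => by simp [Formula.eval]⟩
  by_cases hp : p
  · exact hf.not.mono (fun _ _ _ => not_false) fun _ _ _ => hp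
  · exact hf.mono (fun _ _ h => hp h) fun _ _ h => h.elim

/-- The affine map that takes r to 0 and r' to 1 is applied to the distance. -/
theorem Sep.dist_le (t s : (Fin n → M) → M) [ht : IsTerm t] [hs : IsTerm s] {r r' : ℝ}
    (hr : r < r') :
    Sep E D (fun v => dist (t v) (s v) ≤ r) (fun v => dist (t v) (s v) < r') := by
  obtain ⟨t', ht⟩ := ht.out
  obtain ⟨s', hs⟩ := hs.out
  have h0 : 0 < r' - r := sub_pos.2 hr
  -- The summand 1 - 1 does not change the value, but it raises `v` by 2 and so secures `1 ≤ φ.v`.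
  refine ⟨2, .add (.add (.smul (r' - r)⁻¹ (.dist 0 1)) (.smul (-(r' - r)⁻¹ * r) .one))
    (.add .one (.smul (-1) .one)), ![t', s'], ?_, fun v _ => ?_⟩
  · simp only [Formula.v]
    have := abs_nonneg (r' - r)⁻¹
    have := abs_nonneg (-(r' - r)⁻¹ * r)
    rw [abs_neg, abs_one]
    linarith
  · have : Formula.eval E (.add (.add (.smul (r' - r)⁻¹ (.dist 0 1))
        (.smul (-(r' - r)⁻¹ * r) .one)) (.add .one (.smul (-1) .one))) (assign ![t', s'] v)
        = (dist (t v) (s v) - r) / (r' - r) := by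
      simp only [Formula.eval, assign, ht, hs]
      simp
      ring
    rw [this, div_lt_one h0]
    exact ⟨fun h => div_nonpos_of_nonpos_of_nonneg (by linarith) h0.le, fun h => by linarith⟩

/-- Replace the variable `0` of the context by the variable of a quantifier. -/
def bindVar {m : ℕ} (t : Fin m → Fin (n + 1) ⊕ M) : Fin m → Fin (m + 1) :=
  fun j => Sum.elim (Fin.cases 0 fun _ => j.succ) (fun _ => j.succ) (t j)

/-- The interpretation of the remaining variables of the context under a quantifier. -/
def bindTerm (o : M) {m : ℕ} (t : Fin m → Fin (n + 1) ⊕ M) : Fin m → Fin n ⊕ M :=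
  fun j => Sum.elim (Fin.cases (.inr o) .inl) .inr (t j)

omit [MetricSpace M] in
theorem cons_assign_bindTerm (o : M) {m : ℕ} (t : Fin m → Fin (n + 1) ⊕ M) (v : Fin n → M) (x : M) :
    (Fin.cons x (assign (bindTerm o t) v) : Fin (m + 1) → M) ∘ bindVar t
      = assign t (Fin.cons x v) := by
  funext j
  simp only [Function.comp, bindVar]
  rcases h : t j with i | a
  · induction i using Fin.cases <;> simp [h, assign, bindTerm]
  · simp [h, assign, bindTerm]

/-! ### Quantifiers over separated pairs, and excision. -/

theorem IsModel.sep_all (hM : IsModel E) {P Q : M → (Fin n → M) → Prop}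
    (h : Sep E (fun w : Fin (n + 1) → M => D fun i => w i.succ)
      (fun w => P (w 0) fun i => w i.succ) (fun w => Q (w 0) fun i => w i.succ)) :
    Sep E D (fun v => ∀ x, P x v) (fun v => ∀ x, Q x v) := by
  obtain ⟨m, φ, t, hv, h⟩ := h
  obtain ⟨o⟩ := hM.nonempty
  have key : ∀ v x, (φ.rename (bindVar t)).eval E (Fin.cons x (assign (bindTerm o t) v))
      = φ.eval E (assign t (Fin.cons x v)) := fun v x => by
    rw [Formula.eval_rename, cons_assign_bindTerm]
  refine ⟨m, .sup (φ.rename (bindVar t)), bindTerm o t, by simpa [Formula.v, Formula.v_rename],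
    fun v hD => ?_⟩
  simp only [Formula.eval, key]
  refine ⟨fun hP => ?_, fun hl x => (h (Fin.cons x v) hD).2 (lt_of_le_of_lt ?_ hl)⟩
  · have := hM.nonempty
    refine csSup_le (range_nonempty _) ?_
    rintro _ ⟨x, rfl⟩
    exact (h (Fin.cons x v) hD).1 (hP x)
  · refine le_csSup ⟨φ.v, ?_⟩ ⟨x, rfl⟩
    rintro _ ⟨x, rfl⟩
    exact (abs_le.1 (hM.abs_eval_le _ _)).2

theorem IsModel.sep_ex (hM : IsModel E) {P Q : M → (Fin n → M) → Prop}
    (h : Sep E (fun w : Fin (n + 1) → M => D fun i => w i.succ)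
      (fun w => P (w 0) fun i => w i.succ) (fun w => Q (w 0) fun i => w i.succ)) :
    Sep E D (fun v => ∃ x, P x v) (fun v => ∃ x, Q x v) :=
  (hM.sep_all (P := fun x v => ¬ Q x v) (Q := fun x v => ¬ P x v) h.not).not.mono
    (fun _ _ h => by simpa using h) (fun _ _ h => by simpa using h)

/-- The bound is added to the domain of the body. Predicates that are exact only for members of
given sets can thus be used under bounded quantifiers. -/
theorem IsModel.sep_ball (hM : IsModel E) {s : (Fin n → M) → M} [hs : IsTerm s]
    {P Q : M → (Fin n → M) → Prop}
    (h : Sep E (fun w : Fin (n + 1) → M => D (fun i => w i.succ) ∧ E (w 0) (s fun i => w i.succ))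
      (fun w => P (w 0) fun i => w i.succ) (fun w => Q (w 0) fun i => w i.succ)) :
    Sep E D (fun v => ∀ x, E x (s v) → P x v) (fun v => ∀ x, E x (s v) → Q x v) := by
  obtain ⟨m, φ, t, hv, h⟩ := h
  obtain ⟨o⟩ := hM.nonempty
  obtain ⟨s', hs⟩ := hs.out
  let T : Fin (m + 1) → Fin n ⊕ M := Fin.cons s' (bindTerm o t)
  have key : ∀ v x, ((φ.rename (bindVar t)).rename (liftVar Fin.succ)).eval E
      (Fin.cons x (assign T v)) = φ.eval E (assign t (Fin.cons x v)) := fun v x => by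
    rw [Formula.eval_rename, cons_comp_liftVar, Formula.eval_rename, ← cons_assign_bindTerm o]
    rfl
  have hT : ∀ v, assign T v 0 = s v := fun v => (hs v).symm
  refine ⟨m + 1, .bsup 0 ((φ.rename (bindVar t)).rename (liftVar Fin.succ)), T,
    by simpa [Formula.v, Formula.v_rename], fun v hD => ?_⟩
  simp only [Formula.eval, key, Formula.v_rename]
  rw [hT v]
  split_ifs with hne
  · refine ⟨fun hP => ?_, fun hl x hx => (h (Fin.cons x v) ⟨hD, hx⟩).2 (lt_of_le_of_lt ?_ hl)⟩
    · refine csSup_le (hne.image _) ?_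
      rintro _ ⟨x, hx, rfl⟩
      exact (h (Fin.cons x v) ⟨hD, hx⟩).1 (hP x hx)
    · refine le_csSup ⟨φ.v, ?_⟩ ⟨x, hx, rfl⟩
      rintro _ ⟨x, -, rfl⟩
      exact (abs_le.1 (hM.abs_eval_le _ _)).2
  -- Over an empty set the bounded supremum is `-v ≤ 0`, in agreement with vacuous truth.
  · exact ⟨fun _ => by linarith, fun _ x hx => (hne ⟨x, hx⟩).elim⟩

theorem IsModel.sep_bex (hM : IsModel E) {s : (Fin n → M) → M} [hs : IsTerm s]
    {P Q : M → (Fin n → M) → Prop}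
    (h : Sep E (fun w : Fin (n + 1) → M => D (fun i => w i.succ) ∧ E (w 0) (s fun i => w i.succ))
      (fun w => P (w 0) fun i => w i.succ) (fun w => Q (w 0) fun i => w i.succ)) :
    Sep E D (fun v => ∃ x, E x (s v) ∧ P x v) (fun v => ∃ x, E x (s v) ∧ Q x v) :=
  (hM.sep_ball (P := fun x v => ¬ Q x v) (Q := fun x v => ¬ P x v) h.not).not.mono
    (fun _ _ h => by simpa using h) (fun _ _ h => by simpa using h)

/-- Excision for separated predicates. -/
theorem IsModel.exists_of_sep (hM : IsModel E) {P Q : M → Prop}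
    (h : Sep E (fun _ : Fin 1 → M => True) (fun v => P (v 0)) (fun v => Q (v 0))) :
    ∃ b : M, ∀ c : M, (P c → E c b) ∧ (E c b → Q c) := by
  obtain ⟨m, φ, t, hv, h⟩ := h
  obtain ⟨o⟩ := hM.nonempty
  obtain ⟨b, hb⟩ := hM.excision m (φ.rename (bindVar t)) (assign (bindTerm o t) Fin.elim0) 0 1 one_pos
  refine ⟨b, fun c => ?_⟩
  have key : (φ.rename (bindVar t)).eval E (Fin.cons c (assign (bindTerm o t) Fin.elim0))
      = φ.eval E (assign t (Fin.cons c Fin.elim0)) := by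
    rw [Formula.eval_rename, cons_assign_bindTerm]
  have h' := h (Fin.cons c Fin.elim0) trivial
  rw [← key] at h'
  exact ⟨fun hP => (hb c).1 (h'.1 hP), fun hE => h'.2 ((hb c).2 hE)⟩

end

section

variable {M : Type*} [MetricSpace M] {E : M → M → Prop}

/-! ### Metric extensionality -/

theorem IsMetricSetStructure.ext (hM : IsMetricSetStructure E) {a b : M}
    (h : ∀ x, E x a ↔ E x b) : a = b := by
  have : members E a = members E b := Set.ext h
  rw [← edist_eq_zero, hM.extensional, this, Metric.hausdorffEDist_self]
  simp

/-- Below 1 the truncation is invisible, which is why r ≤ 1 is required. -/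
theorem IsMetricSetStructure.exists_dist_lt (hM : IsMetricSetStructure E) {a b x : M} {r : ℝ}
    (hx : E x a) (h : dist a b < r) (hr : r ≤ 1) : ∃ y, E y b ∧ dist x y < r := by
  have h1 : edist a b < ENNReal.ofReal r := by
    rw [edist_dist]
    exact (ENNReal.ofReal_lt_ofReal_iff (dist_nonneg.trans_lt h)).2 h
  rw [hM.extensional, min_lt_iff] at h1
  have h2 : ENNReal.ofReal r ≤ 1 := ENNReal.ofReal_le_one.2 hr
  obtain ⟨y, hy, hxy⟩ := Metric.exists_edist_lt_of_hausdorffEDist_lt (show x ∈ members E a from hx)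
    (h1.resolve_left h2.not_gt)
  refine ⟨y, hy, ?_⟩
  rw [edist_dist] at hxy
  exact (ENNReal.ofReal_lt_ofReal_iff_of_nonneg dist_nonneg).1 hxy

theorem IsMetricSetStructure.dist_le (hM : IsMetricSetStructure E) {a b : M} {r : ℝ} (hr : 0 ≤ r)
    (h₁ : ∀ x, E x a → ∃ y, E y b ∧ dist x y ≤ r) (h₂ : ∀ y, E y b → ∃ x, E x a ∧ dist x y ≤ r) :
    dist a b ≤ r := by
  have : edist a b ≤ ENNReal.ofReal r := by
    rw [hM.extensional]
    refine min_le_of_right_le (Metric.hausdorffEDist_le_of_mem_edist ?_ ?_)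
    · intro x hx
      obtain ⟨y, hy, h⟩ := h₁ x hx
      exact ⟨y, hy, by rw [edist_dist]; exact ENNReal.ofReal_le_ofReal h⟩
    · intro y hy
      obtain ⟨x, hx, h⟩ := h₂ y hy
      exact ⟨x, hx, by rw [edist_comm, edist_dist]; exact ENNReal.ofReal_le_ofReal h⟩
  rwa [edist_dist, ENNReal.ofReal_le_ofReal_iff hr] at this

/-! ### Comprehension for closed classes -/

/-- Approximations from outside with errors 2⁻ⁿ form a Cauchy sequence in the Hausdorff metric. Its
limit contains F because E is closed, and is contained in the closure of F. -/
theorem IsMetricSetStructure.exists_members_eq_of_approx (hM : IsMetricSetStructure E) {F : Set M}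
    (hF : IsClosed F)
    (h : ∀ δ > 0, ∃ b, (∀ x ∈ F, E x b) ∧ ∀ x, E x b → ∃ y ∈ F, dist x y < δ) :
    ∃ b, members E b = F := by
  have := hM.complete
  have : Nonempty M := let ⟨b, _⟩ := h 1 one_pos; ⟨b⟩
  choose! b hb₁ hb₂ using h
  let u : ℕ → M := fun n => b ((1 / 2) ^ n)
  have hpos : ∀ n : ℕ, (0 : ℝ) < (1 / 2) ^ n := fun n => by positivity
  have hu : CauchySeq u := by
    refine cauchySeq_of_le_geometric (1 / 2) 1 (by norm_num) fun n => ?_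
    rw [one_mul]
    refine hM.dist_le (hpos n).le (fun x hx => ?_) fun x hx => ?_
    · obtain ⟨y, hy, hd⟩ := hb₂ _ (hpos n) x hx
      exact ⟨y, hb₁ _ (hpos _) y hy, hd.le⟩
    · obtain ⟨y, hy, hd⟩ := hb₂ _ (hpos (n + 1)) x hx
      refine ⟨y, hb₁ _ (hpos _) y hy, ?_⟩
      rw [dist_comm]
      refine hd.le.trans ?_
      rw [pow_succ]
      linarith [hpos n]
  obtain ⟨c, hc⟩ := cauchySeq_tendsto_of_complete hu
  refine ⟨c, Subset.antisymm (fun x hx => ?_) fun x hx => ?_⟩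
  · rw [← hF.closure_eq, Metric.mem_closure_iff]
    intro ε hε
    obtain ⟨n, hn⟩ := exists_pow_lt_of_lt_one (half_pos hε) (by norm_num : (1 / 2 : ℝ) < 1)
    obtain ⟨N, hN⟩ := Metric.tendsto_atTop.1 hc (min (ε / 2) 1) (by positivity)
    have hk := hN (max n N) (le_max_right _ _)
    rw [dist_comm] at hk
    obtain ⟨y, hy, hxy⟩ := hM.exists_dist_lt hx hk (min_le_right _ _)
    obtain ⟨z, hz, hyz⟩ := hb₂ _ (hpos _) y hy
    refine ⟨z, hz, (dist_triangle _ y _).trans_lt ?_⟩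
    have : (1 / 2 : ℝ) ^ max n N ≤ (1 / 2) ^ n :=
      pow_le_pow_of_le_one (by norm_num) (by norm_num) (le_max_left _ _)
    linarith [min_le_left (ε / 2) 1]
  · have ht : Filter.Tendsto (fun n => (x, u n)) Filter.atTop (nhds (x, c)) :=
      tendsto_const_nhds.prodMk_nhds hc
    exact hM.isClosed.mem_of_tendsto ht (Filter.Eventually.of_forall fun n => hb₁ _ (hpos n) x hx)

theorem IsModel.exists_members_eq (hM : IsModel E) {F : Set M} (hF : IsClosed F) {δ₀ : ℝ}
    (h₀ : 0 < δ₀) (h : ∀ δ, 0 < δ → δ ≤ δ₀ → Sep E (fun _ : Fin 1 → M => True) (fun v => v 0 ∈ F)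
      (fun v => ∃ y ∈ F, dist (v 0) y < δ)) : ∃ b, members E b = F := by
  refine hM.exists_members_eq_of_approx hF fun δ hδ => ?_
  obtain ⟨b, hb⟩ := hM.exists_of_sep (P := fun x => x ∈ F)
    (Q := fun x => ∃ y ∈ F, dist x y < min δ δ₀) (h _ (lt_min hδ h₀) (min_le_right _ _))
  exact ⟨b, fun x hx => (hb x).1 hx, fun x hx =>
    let ⟨y, hy, hd⟩ := (hb x).2 hx; ⟨y, hy, hd.trans_le (min_le_left _ _)⟩⟩

theorem IsModel.exists_members_eq_of_finite (hM : IsModel E) {F : Set M} (hF : F.Finite) :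
    ∃ b, members E b = F := by
  refine hM.exists_members_eq hF.isClosed one_pos fun δ hδ _ => ?_
  induction F, hF using Set.Finite.induction_on with
  | empty => exact (Sep.const False).mono (fun _ _ h => h) (fun _ _ h => h.elim)
  | @insert a s _ _ ih =>
    refine ((Sep.dist_le (fun v : Fin 1 → M => v 0) (fun _ => a) hδ).or ih).mono ?_ ?_
    · rintro v - (rfl | h)
      · exact .inl (dist_self _).le
      · exact .inr h
    · rintro v - (h | ⟨y, hy, h⟩)
      · exact ⟨a, .inl rfl, h⟩
      · exact ⟨y, .inr hy, h⟩

open Classical in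
/-- The element of `M` with extension `F`, if there is one. -/
noncomputable def IsModel.ofClass (hM : IsModel E) (F : Set M) : M :=
  if h : ∃ b, members E b = F then h.choose else hM.nonempty.some

theorem IsModel.mem_ofClass (hM : IsModel E) {F : Set M} (h : ∃ b, members E b = F) {x : M} :
    E x (hM.ofClass F) ↔ x ∈ F := by
  have : members E (hM.ofClass F) = F := by
    rw [IsModel.ofClass, dif_pos h]
    exact h.choose_spec
  exact Set.ext_iff.1 this x

theorem IsModel.eq_ofClass (hM : IsModel E) {F : Set M} {a : M} : members E a = F → a = hM.ofClass F :=
  fun h => hM.ext fun x => by rw [hM.mem_ofClass ⟨a, h⟩, ← h]; rfl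

/-! ### Finite sets and ordered pairs -/

/-- The unordered pair `{a, b}`. -/
noncomputable def IsModel.upair (hM : IsModel E) (a b : M) : M := hM.ofClass {a, b}

theorem IsModel.mem_upair (hM : IsModel E) {a b x : M} :
    E x (hM.upair a b) ↔ x = a ∨ x = b := by
  rw [IsModel.upair, hM.mem_ofClass (hM.exists_members_eq_of_finite (by simp))]
  simp

/-- The empty set of a model. -/
noncomputable def IsModel.empty (hM : IsModel E) : M := hM.ofClass ∅

theorem IsModel.notMem_empty (hM : IsModel E) {x : M} : ¬ E x hM.empty := by
  rw [IsModel.empty, hM.mem_ofClass (hM.exists_members_eq_of_finite (by simp))]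
  simp

theorem IsModel.dist_empty (hM : IsModel E) {a x : M} (hx : E x a) : dist a hM.empty = 1 := by
  refine le_antisymm (hM.dist_le_one _ _) (not_lt.1 fun h => ?_)
  obtain ⟨y, hy, -⟩ := hM.exists_dist_lt hx h le_rfl
  exact hM.notMem_empty hy

/-- The maximal cross distances rule out matching a with d or b with c. -/
theorem IsModel.dist_upair (hM : IsModel E) {a b c d : M} (h₁ : dist a d = 1) (h₂ : dist b c = 1) :
    dist (hM.upair a b) (hM.upair c d) = max (dist a c) (dist b d) := by
  refine le_antisymm (hM.dist_le (le_max_of_le_left dist_nonneg) ?_ ?_) (max_le ?_ ?_)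
  · rintro x hx
    rcases hM.mem_upair.1 hx with rfl | rfl
    · exact ⟨c, by simp [hM.mem_upair], le_max_left _ _⟩
    · exact ⟨d, by simp [hM.mem_upair], le_max_right _ _⟩
  · rintro x hx
    rcases hM.mem_upair.1 hx with rfl | rfl
    · exact ⟨a, by simp [hM.mem_upair], le_max_left _ _⟩
    · exact ⟨b, by simp [hM.mem_upair], le_max_right _ _⟩
  · refine not_lt.1 fun h => ?_
    obtain ⟨y, hy, hd⟩ := hM.exists_dist_lt (hM.mem_upair.2 (.inl rfl)) h (hM.dist_le_one _ _)
    rcases hM.mem_upair.1 hy with rfl | rfl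
    · exact lt_irrefl _ hd
    · exact absurd (hM.dist_le_one a c) (by linarith)
  · refine not_lt.1 fun h => ?_
    obtain ⟨y, hy, hd⟩ := hM.exists_dist_lt (hM.mem_upair.2 (.inr rfl)) h (hM.dist_le_one _ _)
    rcases hM.mem_upair.1 hy with rfl | rfl
    · exact absurd (hM.dist_le_one b d) (by linarith)
    · exact lt_irrefl _ hd

theorem IsModel.dist_upair_self (hM : IsModel E) (a c : M) :
    dist (hM.upair a a) (hM.upair c c) = dist a c := by
  refine le_antisymm (hM.dist_le dist_nonneg ?_ ?_) (not_lt.1 fun h => ?_)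
  · intro x hx
    exact ⟨c, by simp [hM.mem_upair], by simp_all [hM.mem_upair]⟩
  · intro x hx
    exact ⟨a, by simp [hM.mem_upair], by simp_all [hM.mem_upair]⟩
  · obtain ⟨y, hy, hd⟩ := hM.exists_dist_lt (hM.mem_upair.2 (.inl rfl)) h (hM.dist_le_one _ _)
    rcases hM.mem_upair.1 hy with rfl | rfl <;> exact lt_irrefl _ hd

/-- The ordered pair `⟨x, y⟩`. -/
noncomputable def IsModel.pair (hM : IsModel E) (x y : M) : M :=
  hM.upair (hM.upair (hM.upair x x) hM.empty) (hM.upair (hM.upair y y) (hM.upair y y))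

theorem IsModel.isPair_iff (hM : IsModel E) {p x y : M} : IsPair E p x y ↔ p = hM.pair x y := by
  constructor
  · rintro ⟨o, sx, sy, u, w, ho, hsx, hsy, hu, hw, hp⟩
    obtain rfl : o = hM.empty := hM.eq_ofClass ho
    obtain rfl : sx = hM.upair x x := hM.eq_ofClass (by simpa using hsx)
    obtain rfl : sy = hM.upair y y := hM.eq_ofClass (by simpa using hsy)
    obtain rfl : u = hM.upair (hM.upair x x) hM.empty := hM.eq_ofClass hu
    obtain rfl : w = hM.upair (hM.upair y y) (hM.upair y y) := hM.eq_ofClass (by simpa using hw)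
    exact hM.eq_ofClass hp
  · rintro rfl
    refine ⟨hM.empty, hM.upair x x, hM.upair y y, hM.upair (hM.upair x x) hM.empty,
      hM.upair (hM.upair y y) (hM.upair y y), ?_, ?_, ?_, ?_, ?_, ?_⟩ <;> ext <;>
      simp [members, IsModel.pair, hM.mem_upair, hM.notMem_empty]

/-- A set with ∅ as a member has distance 1 from a set whose only member is nonempty, so first and
second components cannot be confused. The pairing is an isometry for the max metric. -/
theorem IsModel.dist_pair (hM : IsModel E) (x y x' y' : M) :
    dist (hM.pair x y) (hM.pair x' y') = max (dist x x') (dist y y') := by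
  have key : ∀ a b : M, dist (hM.upair (hM.upair a a) hM.empty)
      (hM.upair (hM.upair b b) (hM.upair b b)) = 1 := fun a b => by
    refine le_antisymm (hM.dist_le_one _ _) (not_lt.1 fun h => ?_)
    obtain ⟨z, hz, hd⟩ := hM.exists_dist_lt (hM.mem_upair.2 (.inr rfl)) h le_rfl
    obtain rfl : z = hM.upair b b := by simpa [hM.mem_upair] using hz
    rw [dist_comm, hM.dist_empty (hM.mem_upair.2 (.inl rfl))] at hd
    exact lt_irrefl _ hd
  have h1 : ∀ a, dist (hM.upair a a) hM.empty = 1 := fun a =>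
    hM.dist_empty (hM.mem_upair.2 (.inl rfl))
  have key' : ∀ a b : M, dist (hM.upair (hM.upair a a) (hM.upair a a))
      (hM.upair (hM.upair b b) hM.empty) = 1 := fun a b => by rw [dist_comm, key]
  rw [IsModel.pair, IsModel.pair, hM.dist_upair (key _ _) (key' _ _),
    hM.dist_upair (h1 _) (by rw [dist_comm, h1]), hM.dist_upair_self, hM.dist_upair_self,
    hM.dist_upair_self, dist_self, max_eq_left dist_nonneg]

theorem IsModel.pair_inj (hM : IsModel E) {x y x' y' : M} (h : hM.pair x y = hM.pair x' y') :
    x = x' ∧ y = y' := by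
  have := hM.dist_pair x y x' y'
  rw [h, dist_self] at this
  exact ⟨dist_le_zero.1 (this ▸ le_max_left _ _), dist_le_zero.1 (this ▸ le_max_right _ _)⟩

theorem IsModel.maps_iff (hM : IsModel E) {f x y : M} : Maps E f x y ↔ E (hM.pair x y) f := by
  simp [Maps, hM.isPair_iff]

omit [MetricSpace M] in
theorem IsTerm.lift {n : ℕ} (t : (Fin n → M) → M) [h : IsTerm t] :
    IsTerm fun w : Fin (n + 1) → M => t fun i => w i.succ := by
  obtain ⟨s, hs⟩ := h.out
  refine ⟨⟨Sum.map Fin.succ id s, fun w => ?_⟩⟩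
  rw [hs]
  cases s <;> rfl

variable {n : ℕ} {D : (Fin n → M) → Prop}

/-- Pairs are not terms, so the distance to a pair is unfolded into bounded quantifiers. The
hypotheses on g₁ and g₂ allow this to be iterated through the nested sets of an ordered pair. -/
theorem IsModel.sep_dist_upair (hM : IsModel E) (t : (Fin n → M) → M) [IsTerm t]
    {g₁ g₂ : (Fin n → M) → M}
    (h₁ : ∀ (D : (Fin (n + 1) → M) → Prop) (r r' : ℝ), 0 ≤ r → r < r' → r' ≤ 1 →
      Sep E D (fun w => dist (w 0) (g₁ fun i => w i.succ) ≤ r)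
        (fun w => dist (w 0) (g₁ fun i => w i.succ) < r'))
    (h₂ : ∀ (D : (Fin (n + 1) → M) → Prop) (r r' : ℝ), 0 ≤ r → r < r' → r' ≤ 1 →
      Sep E D (fun w => dist (w 0) (g₂ fun i => w i.succ) ≤ r)
        (fun w => dist (w 0) (g₂ fun i => w i.succ) < r'))
    {r r' : ℝ} (h0 : 0 ≤ r) (hr : r < r') (hr' : r' ≤ 1) :
    Sep E D (fun v => dist (t v) (hM.upair (g₁ v) (g₂ v)) ≤ r)
      (fun v => dist (t v) (hM.upair (g₁ v) (g₂ v)) < r') := by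
  -- The room between r and p yields nearby members, and that between q and r' makes the final
  -- inequality strict.
  obtain ⟨p, hp, hpr⟩ := exists_between hr
  obtain ⟨q, hq, hqr⟩ := exists_between hpr
  have hp0 : 0 ≤ p := h0.trans hp.le
  have hq1 : q ≤ 1 := (hqr.trans_le hr').le
  refine ((hM.sep_ball (s := t) (P := fun z v => dist z (g₁ v) ≤ p ∨ dist z (g₂ v) ≤ p)
    (Q := fun z v => dist z (g₁ v) < q ∨ dist z (g₂ v) < q)
    ((h₁ _ _ _ hp0 hq hq1).or (h₂ _ _ _ hp0 hq hq1))).and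
    ((hM.sep_bex (s := t) (P := fun z v => dist z (g₁ v) ≤ p) (Q := fun z v => dist z (g₁ v) < q)
      (h₁ _ _ _ hp0 hq hq1)).and
    (hM.sep_bex (s := t) (P := fun z v => dist z (g₂ v) ≤ p) (Q := fun z v => dist z (g₂ v) < q)
      (h₂ _ _ _ hp0 hq hq1)))).mono ?_ ?_
  · intro v _ h
    have h' := h.trans_lt hp
    have hp1 := (hpr.le.trans hr')
    refine ⟨fun z hz => ?_, ?_, ?_⟩
    · obtain ⟨y, hy, hd⟩ := hM.exists_dist_lt hz h' hp1
      rcases hM.mem_upair.1 hy with rfl | rfl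
      · exact .inl hd.le
      · exact .inr hd.le
    all_goals
      rw [dist_comm] at h'
    · obtain ⟨y, hy, hd⟩ := hM.exists_dist_lt (hM.mem_upair.2 (.inl rfl)) h' hp1
      exact ⟨y, hy, by rw [dist_comm]; exact hd.le⟩
    · obtain ⟨y, hy, hd⟩ := hM.exists_dist_lt (hM.mem_upair.2 (.inr rfl)) h' hp1
      exact ⟨y, hy, by rw [dist_comm]; exact hd.le⟩
  · rintro v - ⟨ha, ⟨z₁, hz₁, hd₁⟩, ⟨z₂, hz₂, hd₂⟩⟩
    refine (hM.dist_le (hp0.trans hq.le) (fun z hz => ?_) fun z hz => ?_).trans_lt hqr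
    · rcases ha z hz with h | h
      · exact ⟨_, hM.mem_upair.2 (.inl rfl), h.le⟩
      · exact ⟨_, hM.mem_upair.2 (.inr rfl), h.le⟩
    · rcases hM.mem_upair.1 hz with rfl | rfl
      · exact ⟨z₁, hz₁, hd₁.le⟩
      · exact ⟨z₂, hz₂, hd₂.le⟩

theorem IsModel.sep_dist_pair (hM : IsModel E) (t s u : (Fin n → M) → M) [IsTerm t] [IsTerm s]
    [IsTerm u] {r r' : ℝ} (h0 : 0 ≤ r) (hr : r < r') (hr' : r' ≤ 1) :
    Sep E D (fun v => dist (t v) (hM.pair (s v) (u v)) ≤ r)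
      (fun v => dist (t v) (hM.pair (s v) (u v)) < r') := by
  have single : ∀ {n : ℕ} {D : (Fin n → M) → Prop} (t s : (Fin n → M) → M) [IsTerm t] [IsTerm s]
      {r r' : ℝ}, 0 ≤ r → r < r' → r' ≤ 1 →
      Sep E D (fun v => dist (t v) (hM.upair (s v) (s v)) ≤ r)
        (fun v => dist (t v) (hM.upair (s v) (s v)) < r') := by
    intro n D t s _ _ r r' h0 hr hr'
    have := IsTerm.lift s
    exact hM.sep_dist_upair t (fun D r r' h0 hr hr' => Sep.dist_le _ _ hr)
      (fun D r r' h0 hr hr' => Sep.dist_le _ _ hr) h0 hr hr'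
  have := IsTerm.lift s
  have := IsTerm.lift u
  have := IsTerm.lift fun w : Fin (n + 1) → M => s fun i => w i.succ
  have := IsTerm.lift fun w : Fin (n + 1) → M => u fun i => w i.succ
  refine hM.sep_dist_upair t (fun D r r' h0 hr hr' => ?_) (fun D r r' h0 hr hr' => ?_) h0 hr hr'
  · exact hM.sep_dist_upair (fun w => w 0)
      (g₁ := fun w => hM.upair (s fun i => w i.succ) (s fun i => w i.succ))
      (fun D r r' h0 hr hr' => single (fun w => w 0) (fun w => s fun i => w i.succ.succ) h0 hr hr')
      (fun D r r' h0 hr hr' => Sep.dist_le (fun w => w 0) (fun _ => hM.empty) hr) h0 hr hr'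
  · exact hM.sep_dist_upair (fun w => w 0)
      (g₁ := fun w => hM.upair (u fun i => w i.succ) (u fun i => w i.succ))
      (g₂ := fun w => hM.upair (u fun i => w i.succ) (u fun i => w i.succ))
      (fun D r r' h0 hr hr' => single (fun w => w 0) (fun w => u fun i => w i.succ.succ) h0 hr hr')
      (fun D r r' h0 hr hr' => single (fun w => w 0) (fun w => u fun i => w i.succ.succ) h0 hr hr')
      h0 hr hr'

/-- Some member of `a` is at distance less than `δ` from `x`. -/
def Near (E : M → M → Prop) (δ : ℝ) (x a : M) : Prop := ∃ q, E q a ∧ dist q x < δ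

theorem Near.of_mem {δ : ℝ} (hδ : 0 < δ) {x a : M} (h : E x a) : Near E δ x a :=
  ⟨x, h, by rwa [dist_self]⟩

theorem Near.mono {δ δ' : ℝ} (hδ : δ ≤ δ') {x a : M} : Near E δ x a → Near E δ' x a :=
  fun ⟨q, hq, h⟩ => ⟨q, hq, h.trans_le hδ⟩

theorem IsModel.sep_near (hM : IsModel E) (s f : (Fin n → M) → M) [IsTerm s]
    [IsTerm f] {r r' : ℝ} (hr : r < r') :
    Sep E D (fun v => Near E r (s v) (f v)) (fun v => Near E r' (s v) (f v)) := by
  have := IsTerm.lift s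
  refine (hM.sep_bex (s := f) (P := fun q v => dist q (s v) ≤ r)
    (Q := fun q v => dist q (s v) < r') (Sep.dist_le _ _ hr)).mono ?_ fun v _ h => h
  rintro v - ⟨q, hq, h⟩
  exact ⟨q, hq, h.le⟩

theorem IsModel.sep_near_pair (hM : IsModel E) (s u f : (Fin n → M) → M) [IsTerm s] [IsTerm u]
    [IsTerm f] {r r' : ℝ} (h0 : 0 ≤ r) (hr : r < r') (hr' : r' ≤ 1) :
    Sep E D (fun v => Near E r (hM.pair (s v) (u v)) (f v))
      (fun v => Near E r' (hM.pair (s v) (u v)) (f v)) := by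
  have := IsTerm.lift s
  have := IsTerm.lift u
  refine (hM.sep_bex (s := f) (P := fun q v => dist q (hM.pair (s v) (u v)) ≤ r)
    (Q := fun q v => dist q (hM.pair (s v) (u v)) < r')
    (hM.sep_dist_pair (fun w => w 0) (fun w => s fun i => w i.succ) (fun w => u fun i => w i.succ)
      h0 hr hr')).mono ?_ fun v _ h => h
  rintro v - ⟨q, hq, h⟩
  exact ⟨q, hq, h.le⟩

end

section

variable {M : Type*} [MetricSpace M] {E : M → M → Prop}

/-! ### Uniformly discrete sets -/

theorem Sep.subst {n k : ℕ} {D P Q : (Fin n → M) → Prop} (h : Sep E D P Q)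
    {σ : (Fin k → M) → Fin n → M} (hσ : ∀ i, IsTerm fun v => σ v i) :
    Sep E (fun v => D (σ v)) (fun v => P (σ v)) (fun v => Q (σ v)) := by
  obtain ⟨m, φ, t, hv, h⟩ := h
  choose τ hτ using fun i => (hσ i).out
  refine ⟨m, φ, fun j => Sum.elim τ .inr (t j), hv, fun v hD => ?_⟩
  have : assign (fun j => Sum.elim τ .inr (t j)) v = assign t (σ v) := by
    funext j
    simp only [assign]
    cases t j
    · exact (hτ _ v).symm
    · rfl
  rw [this]
  exact h _ hD

theorem Sep.comp {D P Q : M → Prop}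
    (h : Sep E (fun v : Fin 1 → M => D (v 0)) (fun v => P (v 0)) (fun v => Q (v 0))) {k : ℕ}
    (t : (Fin k → M) → M) [ht : IsTerm t] :
    Sep E (fun v => D (t v)) (fun v => P (t v)) (fun v => Q (t v)) :=
  h.subst (σ := fun v _ => t v) fun _ => ht

/-- If the term is isolated from the other members of the set, being near a member is the same as
being a member. -/
theorem IsModel.sep_mem (hM : IsModel E) {n : ℕ} {D : (Fin n → M) → Prop} (t s : (Fin n → M) → M)
    [IsTerm t] [IsTerm s] {ε : ℝ} (hε : 0 < ε)
    (h : ∀ v, D v → ∀ q, E q (s v) → dist q (t v) < ε → q = t v) :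
    Sep E D (fun v => E (t v) (s v)) (fun v => E (t v) (s v)) := by
  refine (hM.sep_near t s (half_lt_self hε)).mono (fun v _ h => .of_mem (half_pos hε) h) ?_
  rintro v hD ⟨q, hq, hd⟩
  exact h v hD q hq hd ▸ hq

theorem Sep.eq {n : ℕ} {D : (Fin n → M) → Prop} (t s : (Fin n → M) → M)
    [IsTerm t] [IsTerm s] {ε : ℝ} (hε : 0 < ε) (h : ∀ v, D v → dist (t v) (s v) < ε → t v = s v) :
    Sep E D (fun v => t v = s v) (fun v => t v = s v) :=
  (Sep.dist_le t s hε).mono (fun v _ h => by rw [h, dist_self]) h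

theorem IsDiscrete.eq_of_dist_lt {ε : ℝ} {A x y : M} (h : IsDiscrete E ε A) (hx : E x A)
    (hy : E y A) (hd : dist x y < ε) : x = y :=
  (h x y hx hy).resolve_right hd.not_ge

theorem isClosed_of_eq_of_dist_lt {F : Set M} {ε : ℝ} (hε : 0 < ε)
    (h : ∀ x ∈ F, ∀ y ∈ F, dist x y < ε → x = y) : IsClosed F :=
  Metric.isClosed_of_pairwise_le_dist hε fun x hx y hy hne =>
    not_lt.1 fun hd => hne (h x hx y hy hd)

/-- Any subclass of a uniformly discrete set is closed, so a predicate that is exact on the members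
of A gives a genuine subset. -/
theorem IsModel.exists_separation (hM : IsModel E) {A : M} (hA : UniformlyDiscrete E A)
    {P : M → Prop} (h : Sep E (fun v : Fin 1 → M => E (v 0) A) (fun v => P (v 0))
      (fun v => P (v 0))) : ∃ b, ∀ x, E x b ↔ E x A ∧ P x := by
  obtain ⟨ε, hε, hA⟩ := hA
  obtain ⟨b, hb⟩ := hM.exists_members_eq (F := {x | E x A ∧ P x})
    (isClosed_of_eq_of_dist_lt hε fun x hx y hy hd => hA.eq_of_dist_lt hx.1 hy.1 hd) one_pos
    fun δ hδ _ => by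
      refine (hM.sep_bex (s := fun _ => A) (P := fun y v => dist (v 0) y ≤ 0 ∧ P y)
        (Q := fun y v => dist (v 0) y < δ ∧ P y)
        ((Sep.dist_le (fun w : Fin 2 → M => w 1) (fun w => w 0) hδ).and
          ((Sep.comp (D := fun x => E x A) (P := P) (Q := P) h fun w : Fin 2 → M => w 0).dom fun v hv => hv.2))).mono ?_ ?_
      · rintro v - h
        exact ⟨v 0, h.1, by simp, h.2⟩
      · rintro v - ⟨y, hy, hd, hP⟩
        exact ⟨y, ⟨hy, hP⟩, hd⟩
  exact ⟨b, fun x => Set.ext_iff.1 hb x⟩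

/-- Points of A closer than ε coincide, so internal subsets of A inherit its discreteness. -/
theorem IsDiscrete.eq_of_sub (hM : IsModel E) {ε : ℝ} {A x y : M} (h : IsDiscrete E ε A)
    (h1 : ε ≤ 1) (hx : Sub E x A) (hy : Sub E y A) (hd : dist x y < ε) : x = y := by
  refine hM.ext fun z => ⟨fun hz => ?_, fun hz => ?_⟩
  · obtain ⟨w, hw, hd⟩ := hM.exists_dist_lt hz hd h1
    exact h.eq_of_dist_lt (hx z hz) (hy w hw) hd ▸ hw
  · obtain ⟨w, hw, hd⟩ := hM.exists_dist_lt hz (by rwa [dist_comm]) h1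
    exact h.eq_of_dist_lt (hy z hz) (hx w hw) hd ▸ hw

theorem IsDiscrete.mono {ε ε' : ℝ} {A : M} (h : IsDiscrete E ε A) (hε : ε' ≤ ε) :
    IsDiscrete E ε' A :=
  fun x y hx hy => (h x y hx hy).imp_right hε.trans

theorem IsModel.exists_power (hM : IsModel E) {A : M} (hA : UniformlyDiscrete E A) :
    ∃ b, ∀ x, E x b ↔ Sub E x A := by
  have hA' := hA
  obtain ⟨ε, hε, hA⟩ : ∃ ε, 0 < ε ∧ ε ≤ 1 ∧ IsDiscrete E ε A := by
    obtain ⟨ε, hε, hA⟩ := hA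
    exact ⟨min ε 1, lt_min hε one_pos, min_le_right _ _, hA.mono (min_le_left _ _)⟩
  obtain ⟨h1, hA⟩ := hA
  obtain ⟨b, hb⟩ := hM.exists_members_eq (F := {x | Sub E x A})
    (isClosed_of_eq_of_dist_lt hε fun x hx y hy hd => hA.eq_of_sub hM h1 hx hy hd) (half_pos hε)
    fun δ hδ hδε => by
      have h4 : δ / 4 < δ / 2 := by linarith
      refine (hM.sep_ball (s := fun v : Fin 1 → M => v 0) (P := fun z _ => Near E (δ / 4) z A)
        (Q := fun z _ => Near E (δ / 2) z A) (hM.sep_near (fun w => w 0) (fun _ => A) h4)).mono ?_ ?_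
      · rintro v - h z hz
        exact .of_mem (by positivity) (h z hz)
      · rintro v - h
        have h2 : δ / 2 < ε / 2 := by linarith
        -- An approximate subset `v 0` of A is rounded to the points of A near it. Rounding is
        -- exact: a point of A within ε/2 of some q in `v 0` is the point of A already known to be
        -- δ/2-close to q.
        obtain ⟨c, hc⟩ := hM.exists_separation (P := fun y => Near E (δ / 2) y (v 0)) hA'
          ((hM.sep_near (fun w : Fin 1 → M => w 0) (fun _ => v 0) h2).mono (fun _ _ h => h) (by
            rintro w hw ⟨q, hq, hd⟩
            obtain ⟨y, hy, hyq⟩ := h q hq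
            have : y = w 0 := hA.eq_of_dist_lt hy hw
              ((dist_triangle _ q _).trans_lt (by linarith))
            exact ⟨q, hq, by rwa [dist_comm, ← this]⟩))
        refine ⟨c, fun x hx => ((hc x).1 hx).1,
          (hM.dist_le (r := δ / 2) (by positivity) (fun z hz => ?_) fun z hz => ?_).trans_lt
            (half_lt_self hδ)⟩
        · obtain ⟨y, hy, hd⟩ := h z hz
          exact ⟨y, (hc y).2 ⟨hy, z, hz, by rwa [dist_comm]⟩, by rw [dist_comm]; exact hd.le⟩
        · obtain ⟨q, hq, hd⟩ := ((hc z).1 hz).2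
          exact ⟨q, hq, hd.le⟩
  exact ⟨b, fun x => Set.ext_iff.1 hb x⟩

theorem IsModel.orderIso_refl (hM : IsModel E) {A : M} (hA : UniformlyDiscrete E A) :
    OrderIso E A A := by
  obtain ⟨ε, hε, hA⟩ := hA
  obtain ⟨f, hf⟩ := hM.exists_members_eq (F := {p | ∃ x, E x A ∧ p = hM.pair x x})
    (isClosed_of_eq_of_dist_lt hε (by
      rintro _ ⟨x, hx, rfl⟩ _ ⟨y, hy, rfl⟩ hd
      rw [hM.dist_pair, max_self] at hd
      rw [hA.eq_of_dist_lt hx hy hd])) one_pos fun δ hδ hδ1 => by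
      refine (hM.sep_bex (s := fun _ => A) (P := fun x v => dist (v 0) (hM.pair x x) ≤ 0)
        (Q := fun x v => dist (v 0) (hM.pair x x) < δ)
        (hM.sep_dist_pair (fun w : Fin 2 → M => w 1) (fun w => w 0) (fun w => w 0) le_rfl hδ hδ1)).mono ?_ ?_
      · rintro v - ⟨x, hx, h⟩
        exact ⟨x, hx, by rw [h, dist_self]⟩
      · rintro v - ⟨x, hx, h⟩
        exact ⟨_, ⟨x, hx, rfl⟩, h⟩
  have hf' : ∀ p, E p f ↔ ∃ x, E x A ∧ p = hM.pair x x := fun p => Set.ext_iff.1 hf p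
  have hmaps : ∀ x y, Maps E f x y ↔ E x A ∧ y = x := fun x y => by
    rw [hM.maps_iff, hf']
    constructor
    · rintro ⟨z, hz, h⟩
      obtain ⟨rfl, rfl⟩ := hM.pair_inj h
      exact ⟨hz, rfl⟩
    · rintro ⟨hx, rfl⟩
      exact ⟨_, hx, rfl⟩
  refine ⟨f, ⟨fun p hp => ?_, fun x hx => ?_, fun x hx => ?_⟩, fun g h g' h' _ _ hg hh => ?_⟩
  · obtain ⟨x, hx, rfl⟩ := (hf' p).1 hp
    exact ⟨x, x, hx, hx, hM.isPair_iff.2 rfl⟩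
  · exact ⟨x, ⟨hx, (hmaps _ _).2 ⟨hx, rfl⟩⟩, fun y hy => ((hmaps _ _).1 hy.2).2⟩
  · exact ⟨x, ⟨hx, (hmaps _ _).2 ⟨hx, rfl⟩⟩, fun y hy => ((hmaps _ _).1 hy.2).2.symm⟩
  · rw [((hmaps _ _).1 hg).2, ((hmaps _ _).1 hh).2]

end

section

variable {M : Type*} [MetricSpace M] {E : M → M → Prop}

/-! ### Approximate inclusion -/

/-- Every member of `b` is at distance less than `r` from some member of `c`. -/
def Le (E : M → M → Prop) (r : ℝ) (b c : M) : Prop := ∀ z, E z b → Near E r z c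

/-- Approximate inclusion between members of `y` at scale `2/5` implies inclusion at a much finer
scale. -/
def Gapped (E : M → M → Prop) (y : M) : Prop :=
  ∀ b c, E b y → E c y → Le E (2 / 5) b c → Le E (1 / 100) b c

/-- Strict approximate inclusion. -/
def Prec (E : M → M → Prop) (c b : M) : Prop := Le E (2 / 5) c b ∧ ¬ Le E (2 / 5) b c

theorem Near.dist_mem (hM : IsMetricSetStructure E) {z z' b b' : M} {r δ ε : ℝ}
    (h : Near E r z b) (hb : dist b b' < δ) (hδ : δ ≤ 1) (hz : dist z z' < ε) :
    Near E (r + δ + ε) z' b' := by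
  obtain ⟨q, hq, hd⟩ := h
  obtain ⟨q', hq', hd'⟩ := hM.exists_dist_lt hq hb hδ
  refine ⟨q', hq', ?_⟩
  have := dist_triangle4 q' q z z'
  rw [dist_comm q' q] at this
  linarith

/-- The gap absorbs the perturbation: 1/100 + 3/20 + 3/20 < 2/5. -/
theorem Gapped.le_of_dist (hM : IsMetricSetStructure E) {y b c b' c' : M} {δ : ℝ}
    (hy : Gapped E y) (hb : E b y) (hc : E c y) (h : Le E (2 / 5) b c) (hbb : dist b b' < δ)
    (hcc : dist c c' < δ) (hδ : δ ≤ 3 / 20) : Le E (2 / 5) b' c' := by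
  intro z hz
  obtain ⟨w, hw, hd⟩ := hM.exists_dist_lt hz (by rwa [dist_comm]) (hδ.trans (by norm_num))
  rw [dist_comm] at hd
  exact ((hy b c hb hc h w hw).dist_mem hM hcc (hδ.trans (by norm_num)) hd).mono (by linarith)

theorem Gapped.le_iff_of_dist (hM : IsMetricSetStructure E) {y y' b c b' c' : M} {δ : ℝ}
    (hy : Gapped E y) (hy' : Gapped E y') (hb : E b y) (hc : E c y) (hb' : E b' y') (hc' : E c' y')
    (hbb : dist b b' < δ) (hcc : dist c c' < δ) (hδ : δ ≤ 3 / 20) :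
    Le E (2 / 5) b c ↔ Le E (2 / 5) b' c' :=
  ⟨fun h => hy.le_of_dist hM hb hc h hbb hcc hδ, fun h => hy'.le_of_dist hM hb' hc' h
    (by rwa [dist_comm]) (by rwa [dist_comm]) hδ⟩

theorem Gapped.prec_iff_of_dist (hM : IsMetricSetStructure E) {y y' b c b' c' : M} {δ : ℝ}
    (hy : Gapped E y) (hy' : Gapped E y') (hb : E b y) (hc : E c y) (hb' : E b' y') (hc' : E c' y')
    (hbb : dist b b' < δ) (hcc : dist c c' < δ) (hδ : δ ≤ 3 / 20) :
    Prec E b c ↔ Prec E b' c' := by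
  rw [Prec, Prec, hy.le_iff_of_dist hM hy' hb hc hb' hc' hbb hcc hδ,
    hy.le_iff_of_dist hM hy' hc hb hc' hb' hcc hbb hδ]

theorem Gapped.le_trans {y b c e : M} (hy : Gapped E y) (hb : E b y) (hc : E c y) (he : E e y)
    (h : Le E (2 / 5) b c) (h' : Le E (2 / 5) c e) : Le E (2 / 5) b e := by
  intro z hz
  obtain ⟨w, hw, hd⟩ := hy b c hb hc h z hz
  obtain ⟨u, hu, hd'⟩ := hy c e hc he h' w hw
  exact ⟨u, hu, (dist_triangle _ w _).trans_lt (by linarith)⟩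

theorem Gapped.prec_trans {y b c e : M} (hy : Gapped E y) (hb : E b y) (hc : E c y) (he : E e y)
    (h : Prec E b c) (h' : Prec E c e) : Prec E b e :=
  ⟨hy.le_trans hb hc he h.1 h'.1, fun h₁ => h'.2 (hy.le_trans he hb hc h₁ h.1)⟩

section Sep

variable {n : ℕ} {D : (Fin n → M) → Prop}

theorem IsModel.sep_le (hM : IsModel E) (s t : (Fin n → M) → M) [IsTerm s] [IsTerm t] {r r' : ℝ}
    (hr : r < r') : Sep E D (fun v => Le E r (s v) (t v)) (fun v => Le E r' (s v) (t v)) := by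
  have := IsTerm.lift t
  exact hM.sep_ball (P := fun z v => Near E r z (t v)) (Q := fun z v => Near E r' z (t v))
    (hM.sep_near (fun w => w 0) (fun w => t fun i => w i.succ) hr)

/-- For members of one gapped element the relation at 2/5 implies the one at 1/100, so the
approximate separation of these scales is exact. -/
theorem IsModel.sep_le_of_gapped (hM : IsModel E) (s t : (Fin n → M) → M) [IsTerm s] [IsTerm t]
    (h : ∀ v, D v → ∃ y, Gapped E y ∧ E (s v) y ∧ E (t v) y) :
    Sep E D (fun v => Le E (2 / 5) (s v) (t v)) (fun v => Le E (2 / 5) (s v) (t v)) :=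
  (hM.sep_le s t (show (1 / 100 : ℝ) < 2 / 5 by norm_num)).mono
    (fun v hD hl => let ⟨_, hy, hs, ht⟩ := h v hD; hy _ _ hs ht hl) fun _ _ h => h

theorem IsModel.sep_prec (hM : IsModel E) (s t : (Fin n → M) → M) [IsTerm s] [IsTerm t]
    (h : ∀ v, D v → ∃ y, Gapped E y ∧ E (s v) y ∧ E (t v) y) :
    Sep E D (fun v => Prec E (s v) (t v)) (fun v => Prec E (s v) (t v)) :=
  (hM.sep_le_of_gapped s t h).and (hM.sep_le_of_gapped t s fun v hD =>
    let ⟨y, hy, hs, ht⟩ := h v hD; ⟨y, hy, ht, hs⟩).not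

end Sep

/-- There is a set of gapped elements that has all sufficiently discrete chains as members. -/
theorem IsModel.exists_gapped (hM : IsModel E) :
    ∃ T, (∀ y, IsChain E y → IsDiscrete E (3 / 5) y → E y T) ∧ ∀ y, E y T → Gapped E y := by
  obtain ⟨T, hT⟩ := hM.exists_of_sep
    -- The constants leave room for excision on both sides, 1/200 < 1/100 and 2/5 < 1/2, and 1/2
    -- stays below the discreteness 3/5 of the chains.
    (P := fun y => ∀ b, E b y → ∀ c, E c y → Le E (1 / 200) b c ∨ ¬ Le E (1 / 2) b c)
    (Q := fun y => ∀ b, E b y → ∀ c, E c y → Le E (1 / 100) b c ∨ ¬ Le E (2 / 5) b c) (by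
      refine hM.sep_ball (hM.sep_ball (.or ?_ (.not ?_)))
      · exact hM.sep_le (fun w : Fin 3 → M => w 1) (fun w => w 0) (by norm_num)
      · exact hM.sep_le (fun w : Fin 3 → M => w 1) (fun w => w 0) (by norm_num))
  refine ⟨T, fun y hc hd => (hT y).1 fun b hb c hc' => ?_, fun y hy b c hb hc h =>
    ((hT y).2 hy b hb c hc).resolve_right (not_not.2 h)⟩
  by_cases hs : Sub E b c
  · exact .inl fun z hz => .of_mem (by norm_num) (hs z hz)
  · refine .inr fun hl => ?_
    have hs' := (hc b c hb hc').resolve_left hs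
    have : dist b c ≤ 1 / 2 := hM.dist_le (by norm_num)
      (fun x hx => let ⟨q, hq, h⟩ := hl x hx; ⟨q, hq, by rw [dist_comm]; exact h.le⟩)
      fun x hx => ⟨x, hs' x hx, by simp⟩
    obtain rfl := hd.eq_of_dist_lt hb hc' (this.trans_lt (by norm_num))
    exact hs fun _ h => h

/-! ### Similarity of initial segments -/

/-- Some element of `M` codes an isomorphism between the initial segments of `y` and `y'` below `b`
and `b'`, up to `θ` for its domain and range and up to `θ'` for the preservation of the order. -/
def IsModel.SegIso (hM : IsModel E) (θ θ' : ℝ) (y b y' b' : M) : Prop :=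
  ∃ f, (∀ c, E c y → Prec E c b → ∃ c', E c' y' ∧ (Prec E c' b' ∧ Near E θ (hM.pair c c') f)) ∧
    (∀ c', E c' y' → Prec E c' b' → ∃ c, E c y ∧ (Prec E c b ∧ Near E θ (hM.pair c c') f)) ∧
    ∀ c, E c y → ∀ c', E c' y' → Near E θ' (hM.pair c c') f → ∀ e, E e y → ∀ e', E e' y' →
      Near E θ' (hM.pair e e') f → (Le E (2 / 5) c e ↔ Le E (2 / 5) c' e')

/-- The initial segments of `y` and `y'` below `b` and `b'` are isomorphic. -/
def IsModel.Sim (hM : IsModel E) (y b y' b' : M) : Prop := hM.SegIso (1 / 100) (1 / 50) y b y' b'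

/-- The code f is replaced by a set g containing the exact pairs close to f. A pair 3/100-near g is
within 3/20 of a pair 1/50-near f, and `Gapped.le_iff_of_dist` carries the order across this error.
-/
theorem IsModel.Sim.improve {hM : IsModel E} {y b y' b' : M} (hy : Gapped E y) (hy' : Gapped E y')
    (h : hM.Sim y b y' b') : hM.SegIso (1 / 200) (3 / 100) y b y' b' := by
  obtain ⟨f, h₁, h₂, h₃⟩ := h
  obtain ⟨g, hg⟩ := hM.exists_of_sep
    (P := fun q => ∃ c, E c y ∧ ∃ c', E c' y' ∧ (dist q (hM.pair c c') ≤ 0 ∧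
      Near E (1 / 100) (hM.pair c c') f))
    (Q := fun q => ∃ c, E c y ∧ ∃ c', E c' y' ∧ (dist q (hM.pair c c') < 1 / 20 ∧
      Near E (1 / 50) (hM.pair c c') f)) (by
      refine hM.sep_bex (hM.sep_bex (.and ?_ ?_))
      · exact hM.sep_dist_pair (fun w : Fin 3 → M => w 2) (fun w => w 1) (fun w => w 0) le_rfl
          (by norm_num) (by norm_num)
      · exact hM.sep_near_pair (fun w : Fin 3 → M => w 1) (fun w => w 0) (fun _ => f) (by norm_num)
          (by norm_num) (by norm_num))
  have hmem : ∀ c c', E c y → E c' y' → Near E (1 / 100) (hM.pair c c') f →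
      Near E (1 / 200) (hM.pair c c') g := fun c c' hc hc' hn =>
    .of_mem (by norm_num) ((hg _).1 ⟨c, hc, c', hc', by simp, hn⟩)
  have hnear : ∀ c₁ c₁', Near E (3 / 100) (hM.pair c₁ c₁') g → ∃ c, E c y ∧ ∃ c', E c' y' ∧
      dist c₁ c < 3 / 20 ∧ dist c₁' c' < 3 / 20 ∧ Near E (1 / 50) (hM.pair c c') f := by
    rintro c₁ c₁' ⟨q, hq, hd⟩
    obtain ⟨c, hc, c', hc', hd', hn⟩ := (hg q).2 hq
    have : dist (hM.pair c₁ c₁') (hM.pair c c') < 3 / 20 := by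
      rw [dist_comm] at hd
      exact (dist_triangle _ q _).trans_lt (by linarith)
    rw [hM.dist_pair, max_lt_iff] at this
    exact ⟨c, hc, c', hc', this.1, this.2, hn⟩
  refine ⟨g, fun c hc hcb => ?_, fun c' hc' hcb => ?_, fun c hc c' hc' hn e he e' he' hn' => ?_⟩
  · obtain ⟨c', hc', hp, hn⟩ := h₁ c hc hcb
    exact ⟨c', hc', hp, hmem _ _ hc hc' hn⟩
  · obtain ⟨c, hc, hp, hn⟩ := h₂ c' hc' hcb
    exact ⟨c, hc, hp, hmem _ _ hc hc' hn⟩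
  · obtain ⟨d, hd, d', hd', hcd, hcd', hdn⟩ := hnear c c' hn
    obtain ⟨k, hk, k', hk', hek, hek', hkn⟩ := hnear e e' hn'
    rw [hy.le_iff_of_dist hM.1 hy hc he hd hk hcd hek le_rfl, h₃ d hd d' hd' hdn k hk k' hk' hkn,
      hy'.le_iff_of_dist hM.1 hy' hc' he' hd' hk' hcd' hek' le_rfl]

/-- By `Sim.improve`, similarity already implies its version with stricter constants, and this slack
makes it exact on gapped elements. -/
theorem IsModel.sep_sim_aux (hM : IsModel E) :
    Sep E (fun v : Fin 4 → M => Gapped E (v 0) ∧ E (v 1) (v 0) ∧ Gapped E (v 2) ∧ E (v 3) (v 2))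
      (fun v => hM.Sim (v 0) (v 1) (v 2) (v 3)) (fun v => hM.Sim (v 0) (v 1) (v 2) (v 3)) := by
  refine Sep.mono (P := fun v => hM.SegIso (1 / 200) (3 / 100) (v 0) (v 1) (v 2) (v 3)) ?_
    (fun v hD h => h.improve hD.1 hD.2.2.1) fun v _ h => h
  unfold IsModel.Sim IsModel.SegIso
  refine hM.sep_ex (.and (hM.sep_ball (.imp ?_ (hM.sep_bex (.and ?_ ?_))))
    (.and (hM.sep_ball (.imp ?_ (hM.sep_bex (.and ?_ ?_))))
    (hM.sep_ball (hM.sep_ball (.imp ?_ (hM.sep_ball (hM.sep_ball (.imp ?_ (.iff ?_ ?_)))))))))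
  · exact hM.sep_prec (fun w : Fin 6 → M => w 0) (fun w => w 3) fun w hw =>
      ⟨w 2, hw.1.1, hw.2, hw.1.2.1⟩
  · exact hM.sep_prec (fun w : Fin 7 → M => w 0) (fun w => w 6) fun w hw =>
      ⟨w 5, hw.1.1.2.2.1, hw.2, hw.1.1.2.2.2⟩
  · exact hM.sep_near_pair (fun w : Fin 7 → M => w 1) (fun w => w 0) (fun w => w 2)
      (by norm_num) (by norm_num) (by norm_num)
  · exact hM.sep_prec (fun w : Fin 6 → M => w 0) (fun w => w 5) fun w hw =>
      ⟨w 4, hw.1.2.2.1, hw.2, hw.1.2.2.2⟩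
  · exact hM.sep_prec (fun w : Fin 7 → M => w 0) (fun w => w 4) fun w hw =>
      ⟨w 3, hw.1.1.1, hw.2, hw.1.1.2.1⟩
  · exact hM.sep_near_pair (fun w : Fin 7 → M => w 0) (fun w => w 1) (fun w => w 2)
      (by norm_num) (by norm_num) (by norm_num)
  · exact hM.sep_near_pair (fun w : Fin 7 → M => w 1) (fun w => w 0) (fun w => w 2)
      (by norm_num) (by norm_num) (by norm_num)
  · exact hM.sep_near_pair (fun w : Fin 9 → M => w 1) (fun w => w 0) (fun w => w 4)
      (by norm_num) (by norm_num) (by norm_num)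
  · exact hM.sep_le_of_gapped (fun w : Fin 9 → M => w 3) (fun w => w 1) fun w hw =>
      ⟨w 5, hw.1.1.1.1.1, hw.1.1.1.2, hw.1.2⟩
  · exact hM.sep_le_of_gapped (fun w : Fin 9 → M => w 2) (fun w => w 0) fun w hw =>
      ⟨w 7, hw.1.1.1.1.2.2.1, hw.1.1.2, hw.2⟩

theorem IsModel.sep_sim (hM : IsModel E) {n : ℕ} {D : (Fin n → M) → Prop}
    (y b y' b' : (Fin n → M) → M) [hy : IsTerm y] [hb : IsTerm b] [hy' : IsTerm y']
    [hb' : IsTerm b'] (h : ∀ v, D v → Gapped E (y v) ∧ E (b v) (y v) ∧ Gapped E (y' v) ∧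
      E (b' v) (y' v)) :
    Sep E D (fun v => hM.Sim (y v) (b v) (y' v) (b' v))
      (fun v => hM.Sim (y v) (b v) (y' v) (b' v)) :=
  (hM.sep_sim_aux.subst (σ := fun v => ![y v, b v, y' v, b' v]) fun i => by
    fin_cases i <;> assumption).dom h

/-- The relation of being close codes the isomorphism, since the order between gapped elements is
stable under such perturbations. -/
theorem IsModel.sim_of_dist (hM : IsModel E) {y b y' b' : M} (hy : Gapped E y) (hy' : Gapped E y')
    (hb : E b y) (hb' : E b' y') (hd : dist y y' < 1 / 20) (hdb : dist b b' < 1 / 20) :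
    hM.Sim y b y' b' := by
  obtain ⟨f, hf⟩ := hM.exists_of_sep
    (P := fun q => ∃ c, E c y ∧ ∃ c', E c' y' ∧ (dist q (hM.pair c c') ≤ 0 ∧ dist c c' ≤ 1 / 20))
    (Q := fun q => ∃ c, E c y ∧ ∃ c', E c' y' ∧ (dist q (hM.pair c c') < 1 / 100 ∧
      dist c c' < 3 / 50)) (by
      refine hM.sep_bex (hM.sep_bex (.and ?_ ?_))
      · exact hM.sep_dist_pair (fun w : Fin 3 → M => w 2) (fun w => w 1) (fun w => w 0) le_rfl
          (by norm_num) (by norm_num)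
      · exact Sep.dist_le (fun w : Fin 3 → M => w 1) (fun w => w 0) (by norm_num))
  have hmem : ∀ c c', E c y → E c' y' → dist c c' ≤ 1 / 20 → Near E (1 / 100) (hM.pair c c') f :=
    fun c c' hc hc' hd => .of_mem (by norm_num) ((hf _).1 ⟨c, hc, c', hc', by simp, hd⟩)
  have hnear : ∀ c c', Near E (1 / 50) (hM.pair c c') f → dist c c' < 3 / 20 := by
    rintro c c' ⟨q, hq, hqc⟩
    obtain ⟨d, -, d', -, hqd, hdd⟩ := (hf q).2 hq
    have : dist (hM.pair c c') (hM.pair d d') < 3 / 100 := by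
      rw [dist_comm] at hqc
      exact (dist_triangle _ q _).trans_lt (by linarith)
    rw [hM.dist_pair, max_lt_iff, dist_comm c'] at this
    exact (dist_triangle4 c d d' c').trans_lt (by linarith)
  refine ⟨f, fun c hc hcb => ?_, fun c' hc' hcb => ?_, fun c hc c' hc' hn e he e' he' hn' =>
    hy.le_iff_of_dist hM.1 hy' hc he hc' he' (hnear _ _ hn) (hnear _ _ hn') le_rfl⟩
  · obtain ⟨c', hc', hcc⟩ := hM.exists_dist_lt hc hd (by norm_num)
    exact ⟨c', hc', (hy.prec_iff_of_dist hM.1 hy' hc hb hc' hb' hcc hdb (by norm_num)).1 hcb,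
      hmem _ _ hc hc' hcc.le⟩
  · rw [dist_comm] at hd
    obtain ⟨c, hc, hcc⟩ := hM.exists_dist_lt hc' hd (by norm_num)
    rw [dist_comm] at hcc
    exact ⟨c, hc, (hy.prec_iff_of_dist hM.1 hy' hc hb hc' hb' hcc hdb (by norm_num)).2 hcb,
      hmem _ _ hc hc' hcc.le⟩

theorem IsModel.sim_refl (hM : IsModel E) {y b : M} (hy : Gapped E y) (hb : E b y) :
    hM.Sim y b y b :=
  hM.sim_of_dist hy hy hb hb (by simp) (by simp)

/-- The same f witnesses the similarity of the smaller initial segments. -/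
theorem IsModel.Sim.forth_back {hM : IsModel E} {y b y' b' : M} (hy : Gapped E y)
    (hy' : Gapped E y') (hb : E b y) (hb' : E b' y') (h : hM.Sim y b y' b') :
    (∀ c, E c y → Prec E c b → ∃ c', E c' y' ∧ Prec E c' b' ∧ hM.Sim y c y' c') ∧
    ∀ c', E c' y' → Prec E c' b' → ∃ c, E c y ∧ Prec E c b ∧ hM.Sim y c y' c' := by
  obtain ⟨f, h₁, h₂, h₃⟩ := h
  have key : ∀ c c', E c y → E c' y' → Prec E c b → Prec E c' b' →
      Near E (1 / 100) (hM.pair c c') f → hM.Sim y c y' c' := by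
    intro c c' hc hc' hp hp' hn
    have prec_iff : ∀ e e', E e y → E e' y' → Near E (1 / 100) (hM.pair e e') f →
        (Prec E e c ↔ Prec E e' c') := fun e e' he he' hn' => by
      have hn := hn.mono (show (1 / 100 : ℝ) ≤ 1 / 50 by norm_num)
      have hn' := hn'.mono (show (1 / 100 : ℝ) ≤ 1 / 50 by norm_num)
      rw [Prec, Prec, h₃ e he e' he' hn' c hc c' hc' hn, h₃ c hc c' hc' hn e he e' he' hn']
    refine ⟨f, fun e he hec => ?_, fun e' he' hec => ?_, h₃⟩
    · obtain ⟨e', he', -, hn'⟩ := h₁ e he (hy.prec_trans he hc hb hec hp)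
      exact ⟨e', he', (prec_iff e e' he he' hn').1 hec, hn'⟩
    · obtain ⟨e, he, -, hn'⟩ := h₂ e' he' (hy'.prec_trans he' hc' hb' hec hp')
      exact ⟨e, he, (prec_iff e e' he he' hn').2 hec, hn'⟩
  refine ⟨fun c hc hp => ?_, fun c' hc' hp' => ?_⟩
  · obtain ⟨c', hc', hp', hn⟩ := h₁ c hc hp
    exact ⟨c', hc', hp', key c c' hc hc' hp hp' hn⟩
  · obtain ⟨c, hc, hp, hn⟩ := h₂ c' hc' hp'
    exact ⟨c, hc, hp, key c c' hc hc' hp hp' hn⟩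

end

section

variable {M : Type*} [MetricSpace M] {E : M → M → Prop}

/-! ### Classes of pointed sets that are invariant under similarity -/

/-- The members of `S` are pairs `⟨y, b⟩` with `b ∈ y ∈ T`, and `S` is invariant under similarity. -/
structure IsModel.IsInv (hM : IsModel E) (T S : M) : Prop where
  pair : ∀ p, E p S → ∃ y, E y T ∧ ∃ b, E b y ∧ p = hM.pair y b
  inv : ∀ y b y' b', E y T → E b y → E y' T → E b' y' → hM.Sim y b y' b' →
    (E (hM.pair y b) S ↔ E (hM.pair y' b') S)

variable {hM : IsModel E} {T : M}

/-- Nearby pointed sets are similar, so an invariant set cannot separate them. -/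
theorem IsModel.IsInv.mem_of_near {S : M} (h : hM.IsInv T S) (hT : ∀ y, E y T → Gapped E y)
    {y b : M} (hy : E y T) (hb : E b y) (hn : Near E (1 / 20) (hM.pair y b) S) :
    E (hM.pair y b) S := by
  obtain ⟨q, hq, hd⟩ := hn
  obtain ⟨y', hy', b', hb', rfl⟩ := h.pair q hq
  rw [hM.dist_pair, max_lt_iff] at hd
  exact (h.inv y' b' y b hy' hb' hy hb
    (hM.sim_of_dist (hT _ hy') (hT _ hy) hb' hb hd.1 hd.2)).1 hq

theorem IsModel.IsInv.sub_of_dist {S S' : M} (h : hM.IsInv T S) (h' : hM.IsInv T S')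
    (hT : ∀ y, E y T → Gapped E y) (hd : dist S S' < 1 / 20) : Sub E S S' := by
  intro p hp
  obtain ⟨y, hy, b, hb, rfl⟩ := h.pair p hp
  obtain ⟨q, hq, hqp⟩ := hM.exists_dist_lt hp hd (by norm_num)
  exact h'.mem_of_near hT hy hb ⟨q, hq, by rwa [dist_comm]⟩

theorem IsModel.IsInv.eq_of_dist {S S' : M} (h : hM.IsInv T S) (h' : hM.IsInv T S')
    (hT : ∀ y, E y T → Gapped E y) (hd : dist S S' < 1 / 20) : S = S' :=
  hM.ext fun p => ⟨h.sub_of_dist h' hT hd p, h'.sub_of_dist h hT (by rwa [dist_comm]) p⟩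

/-- Comprehension for classes of pointed sets that are invariant under similarity. -/
theorem IsModel.exists_isInv (hM : IsModel E) (hT : ∀ y, E y T → Gapped E y) {P : M → M → Prop}
    (hP : ∀ y b y' b', E y T → E b y → E y' T → E b' y' → hM.Sim y b y' b' → (P y b ↔ P y' b'))
    (h : Sep E (fun v : Fin 2 → M => E (v 0) T ∧ E (v 1) (v 0)) (fun v => P (v 0) (v 1))
      (fun v => P (v 0) (v 1))) :
    ∃ S, hM.IsInv T S ∧ ∀ y b, E y T → E b y → (E (hM.pair y b) S ↔ P y b) := by
  have := hM.complete
  have hiso : Isometry fun p : M × M => hM.pair p.1 p.2 :=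
    Isometry.of_dist_eq fun p q => hM.dist_pair _ _ _ _
  -- E is closed, and by invariance P passes to any limit point from a pointed set 1/20-close to it.
  have hF : IsClosed {p : M × M | (E p.1 T ∧ E p.2 p.1) ∧ P p.1 p.2} := by
    refine isClosed_of_closure_subset fun p hp => ?_
    have hc : IsClosed {p : M × M | E p.1 T ∧ E p.2 p.1} :=
      (hM.isClosed.preimage (f := fun p : M × M => (p.1, T)) (by fun_prop)).inter
        (hM.isClosed.preimage (f := fun p : M × M => (p.2, p.1)) (by fun_prop))
    have hp' : E p.1 T ∧ E p.2 p.1 := closure_minimal (fun q hq => hq.1) hc hp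
    obtain ⟨q, hq, hd⟩ := Metric.mem_closure_iff.1 hp (1 / 20) (by norm_num)
    rw [Prod.dist_eq, max_lt_iff] at hd
    exact ⟨hp', (hP _ _ _ _ hp'.1 hp'.2 hq.1.1 hq.1.2 (hM.sim_of_dist (hT _ hp'.1) (hT _ hq.1.1)
      hp'.2 hq.1.2 hd.1 hd.2)).2 hq.2⟩
  obtain ⟨S, hS⟩ := hM.exists_members_eq (hiso.isClosedEmbedding.isClosedMap _ hF) one_pos
    fun δ hδ hδ1 => by
      refine (hM.sep_bex (s := fun _ => T)
        (P := fun y v => ∃ b, E b y ∧ (dist (v 0) (hM.pair y b) ≤ 0 ∧ P y b))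
        (Q := fun y v => ∃ b, E b y ∧ (dist (v 0) (hM.pair y b) < δ ∧ P y b))
        (hM.sep_bex (.and (hM.sep_dist_pair (fun w : Fin 3 → M => w 2) (fun w => w 1) (fun w => w 0)
          le_rfl hδ hδ1) ((h.subst (σ := fun w : Fin 3 → M => ![w 1, w 0]) fun i => by
            fin_cases i <;> (dsimp; infer_instance)).dom fun w hw => ⟨hw.1.2, hw.2⟩)))).mono ?_ ?_
      · rintro v - ⟨⟨y, b⟩, ⟨⟨hy, hb⟩, hP⟩, h⟩
        exact ⟨y, hy, b, hb, by rw [← h, dist_self], hP⟩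
      · rintro v - ⟨y, hy, b, hb, hd, hP⟩
        exact ⟨_, ⟨(y, b), ⟨⟨hy, hb⟩, hP⟩, rfl⟩, hd⟩
  have hS' : ∀ p, E p S ↔ ∃ q : M × M, ((E q.1 T ∧ E q.2 q.1) ∧ P q.1 q.2) ∧
      hM.pair q.1 q.2 = p := Set.ext_iff.1 hS
  have hS'' : ∀ y b, E y T → E b y → (E (hM.pair y b) S ↔ P y b) := by
    intro y b hy hb
    rw [hS']
    constructor
    · rintro ⟨q, hq, h⟩
      obtain ⟨h₁, h₂⟩ := hM.pair_inj h
      rw [← h₁, ← h₂]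
      exact hq.2
    · exact fun h => ⟨(y, b), ⟨⟨hy, hb⟩, h⟩, rfl⟩
  refine ⟨S, ⟨fun p hp => ?_, fun y b y' b' hy hb hy' hb' hs => ?_⟩, hS''⟩
  · obtain ⟨q, hq, h⟩ := (hS' p).1 hp
    exact ⟨_, hq.1.1, _, hq.1.2, h.symm⟩
  · rw [hS'' y b hy hb, hS'' y' b' hy' hb', hP y b y' b' hy hb hy' hb' hs]

/-- The invariant classes form a set. -/
theorem IsModel.exists_forall_isInv (hM : IsModel E) (hT : ∀ y, E y T → Gapped E y) :
    ∃ B, ∀ S, E S B ↔ hM.IsInv T S := by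
  obtain ⟨B, hB⟩ := hM.exists_members_eq (F := {S | hM.IsInv T S}) (δ₀ := 1 / 25)
    (isClosed_of_eq_of_dist_lt (show (0 : ℝ) < 1 / 20 by norm_num)
      fun S hS S' hS' hd => hS.eq_of_dist hS' hT hd) (by norm_num) fun δ hδ hδ1 => by
    have h4 : δ / 4 < δ / 2 := by linarith
    have h2 : δ / 2 ≤ 1 / 50 := by linarith
    -- Approximate invariance: coarse nearness to `v 0` at one pointed set forces fine nearness at
    -- every similar one. Genuine invariant sets satisfy the strong form by `IsInv.mem_of_near`.
    have hsep : Sep E (fun _ : Fin 1 → M => True)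
        (fun v => (∀ p, E p (v 0) → ∃ y, E y T ∧ ∃ b, E b y ∧ dist p (hM.pair y b) ≤ 0) ∧
          ∀ y, E y T → ∀ b, E b y → ∀ y', E y' T → ∀ b', E b' y' → hM.Sim y b y' b' →
            ((Near E (1 / 20) (hM.pair y b) (v 0) → Near E (δ / 4) (hM.pair y' b') (v 0)) ∧
            (Near E (1 / 20) (hM.pair y' b') (v 0) → Near E (δ / 4) (hM.pair y b) (v 0))))
        (fun v => (∀ p, E p (v 0) → ∃ y, E y T ∧ ∃ b, E b y ∧ dist p (hM.pair y b) < δ / 2) ∧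
          ∀ y, E y T → ∀ b, E b y → ∀ y', E y' T → ∀ b', E b' y' → hM.Sim y b y' b' →
            ((Near E (1 / 25) (hM.pair y b) (v 0) → Near E (δ / 2) (hM.pair y' b') (v 0)) ∧
            (Near E (1 / 25) (hM.pair y' b') (v 0) → Near E (δ / 2) (hM.pair y b) (v 0)))) := by
      refine .and (hM.sep_ball (hM.sep_bex (s := fun _ => T) (hM.sep_bex ?_)))
        (hM.sep_ball (s := fun _ => T) (hM.sep_ball (hM.sep_ball (s := fun _ => T)
          (hM.sep_ball (.imp ?_ (.and (.imp ?_ ?_) (.imp ?_ ?_)))))))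
      · exact hM.sep_dist_pair (fun w : Fin 4 → M => w 2) (fun w => w 1) (fun w => w 0) le_rfl
          (by positivity) (by linarith)
      · exact hM.sep_sim (fun w : Fin 5 → M => w 3) (fun w => w 2) (fun w => w 1) (fun w => w 0)
          fun w hw => ⟨hT _ hw.1.1.1.2, hw.1.1.2, hT _ hw.1.2, hw.2⟩
      · exact hM.sep_near_pair (fun w : Fin 5 → M => w 3) (fun w => w 2) (fun w => w 4)
          (by norm_num) (by norm_num) (by norm_num)
      · exact hM.sep_near_pair (fun w : Fin 5 → M => w 1) (fun w => w 0) (fun w => w 4)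
          (by positivity) h4 (by linarith)
      · exact hM.sep_near_pair (fun w : Fin 5 → M => w 1) (fun w => w 0) (fun w => w 4)
          (by norm_num) (by norm_num) (by norm_num)
      · exact hM.sep_near_pair (fun w : Fin 5 → M => w 3) (fun w => w 2) (fun w => w 4)
          (by positivity) h4 (by linarith)
    refine hsep.mono ?_ ?_
    · rintro v - (hS : hM.IsInv T (v 0))
      refine ⟨fun p hp => ?_, fun y hy b hb y' hy' b' hb' hs => ⟨fun h => ?_, fun h => ?_⟩⟩
      · obtain ⟨y, hy, b, hb, rfl⟩ := hS.pair p hp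
        exact ⟨y, hy, b, hb, (dist_self _).le⟩
      · exact .of_mem (by positivity)
          ((hS.inv y b y' b' hy hb hy' hb' hs).1 (hS.mem_of_near hT hy hb h))
      · exact .of_mem (by positivity)
          ((hS.inv y b y' b' hy hb hy' hb' hs).2 (hS.mem_of_near hT hy' hb' h))
    · rintro v - ⟨h₁, h₂⟩
      have h3 : δ / 2 ≤ 1 / 25 := by linarith
      -- An approximately invariant set is rounded to the pointed sets δ/2-near it. Applying `h₂` to
      -- a pointed set and itself shows that nearness at 1/25 and at δ/2 agree, so the rounding is
      -- exact.
      obtain ⟨S, hS, hmem⟩ := hM.exists_isInv hT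
        (P := fun y b => Near E (δ / 2) (hM.pair y b) (v 0))
        (fun y b y' b' hy hb hy' hb' hs => ⟨fun h => (h₂ y hy b hb y' hy' b' hb' hs).1 (h.mono h3),
          fun h => (h₂ y hy b hb y' hy' b' hb' hs).2 (h.mono h3)⟩)
        ((hM.sep_near_pair (fun w : Fin 2 → M => w 0) (fun w => w 1) (fun _ => v 0) (by positivity)
          (show δ / 2 < 1 / 25 by linarith) (by norm_num)).mono (fun _ _ h => h) fun w hw h =>
            (h₂ _ hw.1 _ hw.2 _ hw.1 _ hw.2 (hM.sim_refl (hT _ hw.1) hw.2)).1 h)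
      refine ⟨S, hS, (hM.dist_le (r := δ / 2) (by positivity) (fun p hp => ?_)
        fun p hp => ?_).trans_lt (half_lt_self hδ)⟩
      · obtain ⟨y, hy, b, hb, hd⟩ := h₁ p hp
        exact ⟨_, (hmem y b hy hb).2 ⟨p, hp, hd⟩, hd.le⟩
      · obtain ⟨y, hy, b, hb, rfl⟩ := hS.pair p hp
        obtain ⟨q, hq, hd⟩ := (hmem y b hy hb).1 hp
        exact ⟨q, hq, hd.le⟩
  exact ⟨B, Set.ext_iff.1 hB⟩

/-! ### The successor step for invariant classes -/

/-- `⟨y, b⟩` belongs to `S`, or all `⟨y, c⟩` with `c` strictly below `b` do. -/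
def IsModel.Step (hM : IsModel E) (S y b : M) : Prop :=
  E (hM.pair y b) S ∨ ∀ c, E c y → Prec E c b → E (hM.pair y c) S

/-- The back-and-forth property matches predecessors of b with similar predecessors of b'. -/
theorem IsModel.IsInv.step_iff {S : M} (h : hM.IsInv T S) (hT : ∀ y, E y T → Gapped E y)
    {y b y' b' : M} (hy : E y T) (hb : E b y) (hy' : E y' T) (hb' : E b' y')
    (hs : hM.Sim y b y' b') : hM.Step S y b ↔ hM.Step S y' b' := by
  obtain ⟨h₁, h₂⟩ := hs.forth_back (hT _ hy) (hT _ hy') hb hb'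
  refine or_congr (h.inv _ _ _ _ hy hb hy' hb' hs) ⟨fun H c' hc' hp' => ?_, fun H c hc hp => ?_⟩
  · obtain ⟨c, hc, hp, hs⟩ := h₂ c' hc' hp'
    exact (h.inv _ _ _ _ hy hc hy' hc' hs).1 (H c hc hp)
  · obtain ⟨c', hc', hp', hs⟩ := h₁ c hc hp
    exact (h.inv _ _ _ _ hy hc hy' hc' hs).2 (H c' hc' hp')

/-- `U` contains the successor of `S`. -/
def IsModel.StepLE (hM : IsModel E) (T S U : M) : Prop :=
  ∀ y, E y T → ∀ b, E b y → hM.Step S y b → E (hM.pair y b) U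

/-- `S` is the union of the successors of the members of `A`. -/
def IsModel.IsLim (hM : IsModel E) (T A S : M) : Prop :=
  ∀ y, E y T → ∀ b, E b y → (E (hM.pair y b) S ↔ ∃ U, E U A ∧ hM.Step U y b)

theorem IsModel.StepLE.sub {S U : M} (h : hM.StepLE T S U) (hS : hM.IsInv T S) : Sub E S U := by
  intro p hp
  obtain ⟨y, hy, b, hb, rfl⟩ := hS.pair p hp
  exact h y hy b hb (.inl hp)

theorem IsModel.StepLE.trans {S U V : M} (h : hM.StepLE T S U) (hU : Sub E U V) :
    hM.StepLE T S V :=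
  fun y hy b hb hs => hU _ (h y hy b hb hs)

theorem IsModel.IsLim.stepLE {A S U : M} (h : hM.IsLim T A S) (hU : E U A) : hM.StepLE T U S :=
  fun y hy b hb hs => (h y hy b hb).2 ⟨U, hU, hs⟩

theorem IsModel.IsLim.sub {A S V : M} (h : hM.IsLim T A S) (hS : hM.IsInv T S)
    (hV : ∀ U, E U A → hM.StepLE T U V) : Sub E S V := by
  intro p hp
  obtain ⟨y, hy, b, hb, rfl⟩ := hS.pair p hp
  obtain ⟨U, hU, hs⟩ := (h y hy b hb).1 hp
  exact hV U hU y hy b hb hs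

section Sep

variable {n : ℕ} {D : (Fin n → M) → Prop}

theorem IsModel.sep_pair_mem (hM : IsModel E) (hT : ∀ y, E y T → Gapped E y)
    (y b S : (Fin n → M) → M) [IsTerm y] [IsTerm b] [IsTerm S]
    (h : ∀ v, D v → E (y v) T ∧ E (b v) (y v) ∧ hM.IsInv T (S v)) :
    Sep E D (fun v => E (hM.pair (y v) (b v)) (S v)) (fun v => E (hM.pair (y v) (b v)) (S v)) :=
  (hM.sep_near_pair y b S (show (0 : ℝ) ≤ 1 / 100 by norm_num)
    (show (1 / 100 : ℝ) < 1 / 20 by norm_num) (by norm_num)).mono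
    (fun _ _ h => .of_mem (by norm_num) h)
    fun v hD hn => (h v hD).2.2.mem_of_near hT (h v hD).1 (h v hD).2.1 hn

theorem IsModel.sep_sub (hM : IsModel E) (hT : ∀ y, E y T → Gapped E y)
    (S U : (Fin n → M) → M) [IsTerm S] [IsTerm U]
    (h : ∀ v, D v → hM.IsInv T (S v) ∧ hM.IsInv T (U v)) :
    Sep E D (fun v => Sub E (S v) (U v)) (fun v => Sub E (S v) (U v)) := by
  have := IsTerm.lift U
  refine hM.sep_ball (s := S) (P := fun p v => E p (U v)) (Q := fun p v => E p (U v))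
    ((hM.sep_near (fun w : Fin (n + 1) → M => w 0) (fun w => U fun i => w i.succ)
      (show (1 / 100 : ℝ) < 1 / 20 by norm_num)).mono (fun _ _ h => .of_mem (by norm_num) h) ?_)
  rintro w ⟨hD, hw⟩ hn
  obtain ⟨hS, hU⟩ := h _ hD
  obtain ⟨y, hy, b, hb, hp⟩ := hS.pair _ hw
  rw [hp] at hn ⊢
  exact hU.mem_of_near hT hy hb hn

theorem IsModel.sep_step (hM : IsModel E) (hT : ∀ y, E y T → Gapped E y)
    (S y b : (Fin n → M) → M) [IsTerm y] [IsTerm b] [IsTerm S]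
    (h : ∀ v, D v → E (y v) T ∧ E (b v) (y v) ∧ hM.IsInv T (S v)) :
    Sep E D (fun v => hM.Step (S v) (y v) (b v)) (fun v => hM.Step (S v) (y v) (b v)) := by
  have := IsTerm.lift S
  have := IsTerm.lift y
  have := IsTerm.lift b
  refine .or (hM.sep_pair_mem hT y b S h) (hM.sep_ball (s := y)
    (P := fun c v => Prec E c (b v) → E (hM.pair (y v) c) (S v))
    (Q := fun c v => Prec E c (b v) → E (hM.pair (y v) c) (S v)) (.imp ?_ ?_))
  · exact hM.sep_prec (fun w => w 0) (fun w => b fun i => w i.succ) fun w hw =>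
      ⟨_, hT _ (h _ hw.1).1, hw.2, (h _ hw.1).2.1⟩
  · exact hM.sep_pair_mem hT (fun w => y fun i => w i.succ) (fun w => w 0)
      (fun w => S fun i => w i.succ) fun w hw => ⟨(h _ hw.1).1, hw.2, (h _ hw.1).2.2⟩

theorem IsModel.sep_stepLE (hM : IsModel E) (hT : ∀ y, E y T → Gapped E y)
    (S U : (Fin n → M) → M) [IsTerm S] [IsTerm U]
    (h : ∀ v, D v → hM.IsInv T (S v) ∧ hM.IsInv T (U v)) :
    Sep E D (fun v => hM.StepLE T (S v) (U v)) (fun v => hM.StepLE T (S v) (U v)) := by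
  have := IsTerm.lift S
  have := IsTerm.lift U
  have := IsTerm.lift fun w : Fin (n + 1) → M => S fun i => w i.succ
  have := IsTerm.lift fun w : Fin (n + 1) → M => U fun i => w i.succ
  refine hM.sep_ball (s := fun _ => T)
    (P := fun y v => ∀ b, E b y → hM.Step (S v) y b → E (hM.pair y b) (U v))
    (Q := fun y v => ∀ b, E b y → hM.Step (S v) y b → E (hM.pair y b) (U v))
    (hM.sep_ball (s := fun w : Fin (n + 1) → M => w 0)
    (P := fun b w => hM.Step (S fun i => w i.succ) (w 0) b → E (hM.pair (w 0) b)
      (U fun i => w i.succ))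
    (Q := fun b w => hM.Step (S fun i => w i.succ) (w 0) b → E (hM.pair (w 0) b)
      (U fun i => w i.succ)) (.imp ?_ ?_))
  · exact hM.sep_step hT (fun w => S fun i => w i.succ.succ) (fun w => w 1) (fun w => w 0)
      fun w hw => ⟨hw.1.2, hw.2, (h _ hw.1.1).1⟩
  · exact hM.sep_pair_mem hT (fun w => w 1) (fun w => w 0) (fun w => U fun i => w i.succ.succ)
      fun w hw => ⟨hw.1.2, hw.2, (h _ hw.1.1).2⟩

theorem IsModel.sep_isLim (hM : IsModel E) (hT : ∀ y, E y T → Gapped E y)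
    (A S : (Fin n → M) → M) [IsTerm A] [IsTerm S]
    (h : ∀ v, D v → (∀ U, E U (A v) → hM.IsInv T U) ∧ hM.IsInv T (S v)) :
    Sep E D (fun v => hM.IsLim T (A v) (S v)) (fun v => hM.IsLim T (A v) (S v)) := by
  have := IsTerm.lift S
  have := IsTerm.lift A
  have := IsTerm.lift fun w : Fin (n + 1) → M => S fun i => w i.succ
  have := IsTerm.lift fun w : Fin (n + 1) → M => A fun i => w i.succ
  refine hM.sep_ball (s := fun _ => T)
    (P := fun y v => ∀ b, E b y → (E (hM.pair y b) (S v) ↔ ∃ U, E U (A v) ∧ hM.Step U y b))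
    (Q := fun y v => ∀ b, E b y → (E (hM.pair y b) (S v) ↔ ∃ U, E U (A v) ∧ hM.Step U y b))
    (hM.sep_ball (s := fun w : Fin (n + 1) → M => w 0)
    (P := fun b w => (E (hM.pair (w 0) b) (S fun i => w i.succ) ↔
      ∃ U, E U (A fun i => w i.succ) ∧ hM.Step U (w 0) b))
    (Q := fun b w => (E (hM.pair (w 0) b) (S fun i => w i.succ) ↔
      ∃ U, E U (A fun i => w i.succ) ∧ hM.Step U (w 0) b)) (.iff ?_ ?_))
  · exact hM.sep_pair_mem hT (fun w => w 1) (fun w => w 0) (fun w => S fun i => w i.succ.succ)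
      fun w hw => ⟨hw.1.2, hw.2, (h _ hw.1.1).2⟩
  · refine hM.sep_bex (s := fun w : Fin (n + 1 + 1) → M => A fun i => w i.succ.succ)
      (P := fun U w => hM.Step U (w 1) (w 0)) (Q := fun U w => hM.Step U (w 1) (w 0)) ?_
    exact hM.sep_step hT (fun w => w 0) (fun w => w 2) (fun w => w 1)
      fun w hw => ⟨hw.1.1.2, hw.1.2, (h _ hw.1.1.1).1 _ hw.2⟩

end Sep

theorem IsModel.exists_isLim (hM : IsModel E) (hT : ∀ y, E y T → Gapped E y) {A : M}
    (hA : ∀ U, E U A → hM.IsInv T U) : ∃ S, hM.IsInv T S ∧ hM.IsLim T A S := by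
  obtain ⟨S, hS, h⟩ := hM.exists_isInv hT (P := fun y b => ∃ U, E U A ∧ hM.Step U y b)
    (fun y b y' b' hy hb hy' hb' hs => exists_congr fun U => and_congr_right fun hU =>
      (hA U hU).step_iff hT hy hb hy' hb' hs) (by
    refine hM.sep_bex (s := fun _ => A) (P := fun U v => hM.Step U (v 0) (v 1))
      (Q := fun U v => hM.Step U (v 0) (v 1)) ?_
    exact hM.sep_step hT (fun w : Fin 3 → M => w 0) (fun w => w 1) (fun w => w 2)
      fun w hw => ⟨hw.1.1, hw.1.2, hA _ hw.2⟩)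
  exact ⟨S, hS, fun y hy b hb => h y b hy hb⟩

end

section

variable {M : Type*} [MetricSpace M] {E : M → M → Prop}

/-! ### The tower of invariant classes -/

/-- `G` is the least set of invariant classes that contains the union of the successors of any of
its subsets. -/
structure IsModel.IsTower (hM : IsModel E) (T G : M) : Prop where
  isInv : ∀ S, E S G → hM.IsInv T S
  lim_mem : ∀ A S, Sub E A G → hM.IsInv T S → hM.IsLim T A S → E S G
  minimal : ∀ K, (∀ A S, Sub E A K → E S G → hM.IsLim T A S → E S K) → Sub E K G → Sub E G K

variable {hM : IsModel E} {T : M}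

theorem isDiscrete_of_isInv (hT : ∀ y, E y T → Gapped E y) {B : M}
    (hB : ∀ S, E S B → hM.IsInv T S) : IsDiscrete E (1 / 20) B :=
  fun _ _ hS hS' => or_iff_not_imp_right.2 fun h =>
    (hB _ hS).eq_of_dist (hB _ hS') hT (not_le.1 h)

/-- G is the intersection of all subsets of B closed under limits of steps. This is exact
comprehension, as B and its power set are available and all predicates involved are exact on them.
-/
theorem IsModel.exists_isTower (hM : IsModel E) (hT : ∀ y, E y T → Gapped E y) :
    ∃ G, hM.IsTower T G := by
  obtain ⟨B, hB⟩ := hM.exists_forall_isInv hT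
  have hBd : IsDiscrete E (1 / 20) B := isDiscrete_of_isInv hT fun S => (hB S).1
  have hBu : UniformlyDiscrete E B := ⟨_, by norm_num, hBd⟩
  obtain ⟨p, hp⟩ := hM.exists_power hBu
  have hmem : ∀ x g t, Sub E x B → E t x → Sub E g B → ∀ q, E q g → dist q t < 1 / 20 → q = t :=
    fun x g t hx ht hg q hq hd => hBd.eq_of_dist_lt (hg q hq) (hx t ht) hd
  obtain ⟨G, hG⟩ := hM.exists_separation hBu (P := fun S => ∀ g, E g p →
    (∀ A, E A p → (∀ U, E U A → E U g) → ∀ S', E S' B → hM.IsLim T A S' → E S' g) → E S g) (by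
      refine hM.sep_ball (s := fun _ => p) (.imp (hM.sep_ball (s := fun _ => p) (.imp
        (hM.sep_ball ?_) (hM.sep_ball (s := fun _ => B) (.imp ?_ ?_)))) ?_)
      · exact hM.sep_mem (fun w : Fin 4 → M => w 0) (fun w => w 2) (by norm_num) fun w hw =>
          hmem _ _ _ ((hp _).1 hw.1.2) hw.2 ((hp _).1 hw.1.1.2)
      · exact hM.sep_isLim hT (fun w : Fin 4 → M => w 1) (fun w => w 0) fun w hw =>
          ⟨fun U hU => (hB U).1 ((hp _).1 hw.1.2 U hU), (hB _).1 hw.2⟩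
      · exact hM.sep_mem (fun w : Fin 4 → M => w 0) (fun w => w 2) (by norm_num) fun w hw =>
          hmem B _ _ (fun _ h => h) hw.2 ((hp _).1 hw.1.1.2)
      · exact hM.sep_mem (fun w : Fin 2 → M => w 1) (fun w => w 0) (by norm_num) fun w hw =>
          hmem B _ _ (fun _ h => h) hw.1 ((hp _).1 hw.2))
  have hGB : Sub E G B := fun S hS => ((hG S).1 hS).1
  have hlim : ∀ A S, Sub E A G → hM.IsInv T S → hM.IsLim T A S → E S G := fun A S hA hS hl =>
    (hG S).2 ⟨(hB S).2 hS, fun g hg hcl => hcl A ((hp A).2 fun U hU => hGB U (hA U hU))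
      (fun U hU => ((hG U).1 (hA U hU)).2 g hg hcl) S ((hB S).2 hS) hl⟩
  refine ⟨G, fun S hS => (hB S).1 (hGB S hS), hlim, fun K hK hKG S hS => ?_⟩
  refine ((hG S).1 hS).2 K ((hp K).2 fun U hU => hGB U (hKG U hU)) fun A _ hA S' hS' hl =>
    hK A S' hA (hlim A S' (fun U hU => hKG U (hA U hU)) ((hB S').1 hS') hl) hl

/-! ### Comparability and well-ordering of the tower. -/

namespace IsModel.IsTower

variable {G : M}

theorem uniformlyDiscrete (hG : hM.IsTower T G) (hT : ∀ y, E y T → Gapped E y) :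
    UniformlyDiscrete E G :=
  ⟨_, by norm_num, isDiscrete_of_isInv hT hG.isInv⟩

theorem induction (hG : hM.IsTower T G) (hT : ∀ y, E y T → Gapped E y) {P : M → Prop}
    (hP : Sep E (fun v : Fin 1 → M => E (v 0) G) (fun v => P (v 0)) (fun v => P (v 0)))
    (h : ∀ A S, (∀ U, E U A → E U G ∧ P U) → E S G → hM.IsLim T A S → P S) {S : M}
    (hS : E S G) : P S := by
  obtain ⟨K, hK⟩ := hM.exists_separation (hG.uniformlyDiscrete hT) hP
  exact ((hK S).1 (hG.minimal K (fun A S hA hS hl => (hK S).2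
    ⟨hS, h A S (fun U hU => (hK U).1 (hA U hU)) hS hl⟩) (fun U hU => ((hK U).1 hU).1) S hS)).2

/-- First half of Zermelo's argument: a stage c that no smaller stage can step past is comparable
with every stage. -/
theorem sub_or_stepLE_of_extreme (hG : hM.IsTower T G) (hT : ∀ y, E y T → Gapped E y) {c : M}
    (hc : E c G) (h : ∀ x, E x G → Sub E x c → x = c ∨ hM.StepLE T x c) {x : M} (hx : E x G) :
    Sub E x c ∨ hM.StepLE T c x := by
  refine hG.induction hT (P := fun x => Sub E x c ∨ hM.StepLE T c x) (.or ?_ ?_)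
    (fun A S hA hS hl => ?_) hx
  · exact hM.sep_sub hT (fun w : Fin 1 → M => w 0) (fun _ => c) fun w hw =>
      ⟨hG.isInv _ hw, hG.isInv _ hc⟩
  · exact hM.sep_stepLE hT (fun _ : Fin 1 → M => c) (fun w => w 0) fun w hw =>
      ⟨hG.isInv _ hc, hG.isInv _ hw⟩
  · refine or_iff_not_imp_right.2 fun hn => hl.sub (hG.isInv S hS) fun U hU => ?_
    have hUS := hl.stepLE hU
    rcases (hA U hU).2 with h₁ | h₁
    · rcases h U (hA U hU).1 h₁ with rfl | h₂
      · exact (hn hUS).elim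
      · exact h₂
    · exact (hn (h₁.trans (hUS.sub (hG.isInv U (hA U hU).1)))).elim

/-- Second half of Zermelo's argument: by induction, every stage has the property required of c in
`sub_or_stepLE_of_extreme`. -/
theorem eq_or_stepLE_of_sub (hG : hM.IsTower T G) (hT : ∀ y, E y T → Gapped E y) {c : M}
    (hc : E c G) : ∀ x, E x G → Sub E x c → x = c ∨ hM.StepLE T x c := by
  refine hG.induction hT (P := fun c => ∀ x, E x G → Sub E x c → x = c ∨ hM.StepLE T x c)
    (hM.sep_ball (s := fun _ => G) (.imp ?_ (.or ?_ ?_))) (fun A S hA hS hl x hx hxS => ?_) hc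
  · exact hM.sep_sub hT (fun w : Fin 2 → M => w 0) (fun w => w 1) fun w hw =>
      ⟨hG.isInv _ hw.2, hG.isInv _ hw.1⟩
  · exact Sep.eq (fun w : Fin 2 → M => w 0) (fun w => w 1) (by norm_num) fun w hw =>
      (hG.isInv _ hw.2).eq_of_dist (hG.isInv _ hw.1) hT
  · exact hM.sep_stepLE hT (fun w : Fin 2 → M => w 0) (fun w => w 1) fun w hw =>
      ⟨hG.isInv _ hw.2, hG.isInv _ hw.1⟩
  · refine or_iff_not_imp_left.2 fun hne => ?_
    have hn : ¬ Sub E S x := fun h => hne (hM.ext fun z => ⟨hxS z, h z⟩)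
    obtain ⟨U, hU, hUx⟩ : ∃ U, E U A ∧ ¬ hM.StepLE T U x := by
      by_contra! H
      exact hn (hl.sub (hG.isInv S hS) H)
    obtain ⟨hUG, hext⟩ := hA U hU
    have hUS := hl.stepLE hU
    have hxU := (hG.sub_or_stepLE_of_extreme hT hUG hext hx).resolve_right hUx
    rcases hext x hx hxU with rfl | h
    · exact hUS
    · exact h.trans (hUS.sub (hG.isInv U hUG))

theorem sub_or_stepLE (hG : hM.IsTower T G) (hT : ∀ y, E y T → Gapped E y) {x c : M}
    (hx : E x G) (hc : E c G) : Sub E x c ∨ hM.StepLE T c x :=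
  hG.sub_or_stepLE_of_extreme hT hc (hG.eq_or_stepLE_of_sub hT hc) hx

theorem isChain (hG : hM.IsTower T G) (hT : ∀ y, E y T → Gapped E y) : IsChain E G :=
  fun _ c hb hc => (hG.sub_or_stepLE hT hb hc).imp_right fun h => h.sub (hG.isInv c hc)

/-- No stage gets beyond one that is closed under the step. -/
theorem sub_of_stepLE_self (hG : hM.IsTower T G) (hT : ∀ y, E y T → Gapped E y) {m x : M}
    (hm : E m G) (h : hM.StepLE T m m) (hx : E x G) : Sub E x m := by
  refine hG.induction hT (P := fun x => Sub E x m) ?_ (fun A S hA hS hl => ?_) hx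
  · exact hM.sep_sub hT (fun w : Fin 1 → M => w 0) (fun _ => m) fun w hw =>
      ⟨hG.isInv _ hw, hG.isInv _ hm⟩
  · refine hl.sub (hG.isInv S hS) fun U hU => ?_
    rcases hG.eq_or_stepLE_of_sub hT hm U (hA U hU).1 (hA U hU).2 with rfl | h'
    · exact h
    · exact h'

/-- The union of the steps of all stages is itself a stage, so it contains its own step. -/
theorem exists_top (hG : hM.IsTower T G) (hT : ∀ y, E y T → Gapped E y) :
    ∃ L, E L G ∧ hM.StepLE T L L := by
  obtain ⟨L, hL, hl⟩ := hM.exists_isLim hT hG.isInv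
  have hLG := hG.lim_mem G L (fun _ h => h) hL hl
  exact ⟨L, hLG, hl.stepLE hLG⟩

theorem isWellOrdered (hG : hM.IsTower T G) (hT : ∀ y, E y T → Gapped E y) :
    IsWellOrdered E G := by
  rintro d hd ⟨s, hs⟩
  obtain ⟨l, hl⟩ := hM.exists_separation (hG.uniformlyDiscrete hT)
    (P := fun S => ∀ U, E U d → Sub E S U ∧ ¬ S = U) (by
      refine hM.sep_ball (s := fun _ => d) (.and ?_ (.not ?_))
      · exact hM.sep_sub hT (fun w : Fin 2 → M => w 1) (fun w => w 0) fun w hw =>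
          ⟨hG.isInv _ hw.1, hG.isInv _ (hd _ hw.2)⟩
      · exact Sep.eq (fun w : Fin 2 → M => w 1) (fun w => w 0) (by norm_num) fun w hw =>
          (hG.isInv _ hw.1).eq_of_dist (hG.isInv _ (hd _ hw.2)) hT)
  have hlG : Sub E l G := fun S hS => ((hl S).1 hS).1
  -- The candidate m is the limit of the strict lower bounds of d. If m were not in d, it would be
  -- such a bound itself, hence closed under the step and the top of G, which forces m = s ∈ d.
  obtain ⟨m, hm, hlim⟩ := hM.exists_isLim hT fun U hU => hG.isInv U (hlG U hU)
  have hmG := hG.lim_mem l m hlG hm hlim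
  have hmd : ∀ x, E x d → Sub E m x := fun x hx => hlim.sub hm fun U hU =>
    (hG.eq_or_stepLE_of_sub hT (hd x hx) U (hlG U hU) (((hl U).1 hU).2 x hx).1).resolve_left
      (((hl U).1 hU).2 x hx).2
  refine ⟨m, ?_, hmd⟩
  by_contra hn
  have hml : E m l := (hl m).2 ⟨hmG, fun U hU => ⟨hmd U hU, fun h => hn (h ▸ hU)⟩⟩
  have hsm := hG.sub_of_stepLE_self hT hmG (hlim.stepLE hml) (hd s hs)
  obtain rfl : m = s := hM.ext fun z => ⟨hmd s hs z, hsm z⟩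
  exact hn hs

end IsModel.IsTower

/-! ### The tower is too long for discrete chains -/

theorem IsDiscrete.le_iff_sub (hM : IsModel E) {x b c : M} (hx : IsDiscrete E (3 / 5) x)
    (hc : IsChain E x) (hb : E b x) (hcx : E c x) : Le E (2 / 5) b c ↔ Sub E b c := by
  refine ⟨fun h => ?_, fun h z hz => .of_mem (by norm_num) (h z hz)⟩
  refine (hc b c hb hcx).elim id fun hs => ?_
  have : dist b c ≤ 2 / 5 := hM.dist_le (by norm_num)
    (fun z hz => let ⟨q, hq, hd⟩ := h z hz; ⟨q, hq, by rw [dist_comm]; exact hd.le⟩)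
    fun z hz => ⟨z, hs z hz, by rw [dist_self]; norm_num⟩
  rw [hx.eq_of_dist_lt hb hcx (this.trans_lt (by norm_num))]
  exact fun _ h => h

theorem IsModel.IsTower.not_orderIso {G : M} (hG : hM.IsTower T G)
    (hT : ∀ y, E y T → Gapped E y) {x : M} (hxT : E x T) (hxd : IsDiscrete E (3 / 5) x)
    (hxc : IsChain E x) (hxw : IsWellOrdered E x) : ¬ OrderIso E x G := by
  rintro ⟨h, ⟨hpair, hfun, hsurj⟩, hiso⟩
  have hxu : UniformlyDiscrete E x := ⟨_, by norm_num, hxd⟩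
  have hGd := isDiscrete_of_isInv hT hG.isInv
  have prec_iff : ∀ b c, E b x → E c x → (Prec E c b ↔ Sub E c b ∧ ¬ Sub E b c) :=
    fun b c hb hc => by rw [Prec, hxd.le_iff_sub hM hxc hc hb, hxd.le_iff_sub hM hxc hb hc]
  obtain ⟨L, hL, hLL⟩ := hG.exists_top hT
  -- A least b with ⟨x, b⟩ outside L would be added by the step, but L is closed under it.
  have hA : ∀ b, E b x → E (hM.pair x b) L := by
    obtain ⟨d, hd⟩ := hM.exists_separation hxu (P := fun b => ¬ E (hM.pair x b) L)
      (.not (hM.sep_pair_mem hT (fun _ : Fin 1 → M => x) (fun w => w 0) (fun _ => L) fun w hw =>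
        ⟨hxT, hw, hG.isInv L hL⟩))
    by_contra! hne
    obtain ⟨b₀, hb₀, hb₀L⟩ := hne
    obtain ⟨b, hb, hmin⟩ := hxw d (fun c hc => ((hd c).1 hc).1) ⟨b₀, (hd b₀).2 ⟨hb₀, hb₀L⟩⟩
    have hb' := (hd b).1 hb
    refine hb'.2 (hLL x hxT b hb'.1 (.inr fun c hc hp => ?_))
    by_contra hcL
    exact ((prec_iff b c hb'.1 hc).1 hp).2 (hmin c ((hd c).2 ⟨hc, hcL⟩))
  -- Along G: if b is matched with U, then ⟨x, b⟩ lies in no stage contained in U.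
  have hB : ∀ b, E b x → ∀ U, E U G → E (hM.pair b U) h → Sub E L U → ¬ E (hM.pair x b) L := by
    refine hG.induction hT (P := fun S => ∀ b, E b x → ∀ U, E U G → E (hM.pair b U) h →
      Sub E S U → ¬ E (hM.pair x b) S) (hM.sep_ball (s := fun _ => x) (hM.sep_ball (s := fun _ => G)
        (.imp ?_ (.imp ?_ (.not ?_))))) ?_ hL
    · refine (hM.sep_near_pair (fun w : Fin 3 → M => w 1) (fun w => w 0) (fun _ => h)
        (show (0 : ℝ) ≤ 1 / 100 by norm_num) (show (1 / 100 : ℝ) < 1 / 20 by norm_num)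
        (by norm_num)).mono (fun _ _ h => .of_mem (by norm_num) h) ?_
      rintro w ⟨⟨-, hw₁⟩, hw₀⟩ ⟨q, hq, hd⟩
      obtain ⟨b, U, hb, hU, hp⟩ := hpair q hq
      obtain rfl := hM.isPair_iff.1 hp
      rw [hM.dist_pair, max_lt_iff] at hd
      rwa [← hxd.eq_of_dist_lt hb hw₁ (hd.1.trans (by norm_num)), ← hGd.eq_of_dist_lt hU hw₀ hd.2]
    · exact hM.sep_sub hT (fun w : Fin 3 → M => w 2) (fun w => w 0) fun w hw =>
        ⟨hG.isInv _ hw.1.1, hG.isInv _ hw.2⟩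
    · exact hM.sep_pair_mem hT (fun _ : Fin 3 → M => x) (fun w => w 1) (fun w => w 2) fun w hw =>
        ⟨hxT, hw.1.2, hG.isInv _ hw.1.1⟩
    · intro A S hA hS hl b hb U hU hbU hSU hbS
      obtain ⟨V, hV, hstep⟩ := (hl x hxT b hb).1 hbS
      obtain ⟨hVG, hVind⟩ := hA V hV
      have hVS : Sub E V S := (hl.stepLE hV).sub (hG.isInv V hVG)
      have hbV := hVind b hb U hU hbU fun z hz => hSU z (hVS z hz)
      obtain ⟨c, ⟨hc, hcV⟩, -⟩ := hsurj V hVG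
      have hcV' := hVind c hc V hVG (hM.maps_iff.1 hcV) fun _ h => h
      -- Here c is matched with V, so ⟨x, c⟩ ∉ V and c is not strictly below b. But V ⊆ U gives c ⊆
      -- b, hence b ⊆ c and U ⊆ V, which puts ⟨x, b⟩ into V.
      have hn : ¬ Prec E c b := fun hp => hcV' (hstep.resolve_left hbV c hc hp)
      have hiff := hiso c b V U hc hb hcV (hM.maps_iff.2 hbU)
      have hcb : Sub E c b := hiff.2 fun z hz => hSU z (hVS z hz)
      have hbc : Sub E b c := by
        by_contra hbc
        exact hn ((prec_iff b c hb hc).2 ⟨hcb, hbc⟩)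
      have hUV : Sub E U V := (hiso b c U V hb hc (hM.maps_iff.2 hbU) hcV).1 hbc
      exact hbV (hUV _ (hSU _ hbS))
  obtain ⟨b, ⟨hb, hbL⟩, -⟩ := hsurj L hL
  exact hB b hb L hL (hM.maps_iff.1 hbL) (fun _ h => h) (hA b hb)

/-- Some ordinal of `M` has scale less than `1`. -/
theorem IsModel.exists_scale_lt_one (hM : IsModel E) : ∃ a, Represents E a (otp E a) ∧
    scale E (otp E a) < 1 := by
  obtain ⟨T, hT₁, hT⟩ := hM.exists_gapped
  obtain ⟨G, hG⟩ := hM.exists_isTower hT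
  have hGu := hG.uniformlyDiscrete hT
  refine ⟨G, ⟨hGu, hG.isChain hT, hG.isWellOrdered hT, rfl⟩, not_le.1 fun hs => ?_⟩
  -- Scale above 3/5 would give a 3/5-discrete well-ordered chain isomorphic to G; the set of radii
  -- is nonempty because `sSup ∅ = 0`.
  have hs' : 3 / 5 < scale E (otp E G) := lt_of_lt_of_le (by norm_num) hs
  have hne : {r : ℝ | 0 < r ∧ r ≤ 1 ∧ ∃ a, IsDiscrete E r a ∧
      Represents E a (otp E G)}.Nonempty := by
    by_contra hne
    rw [scale, Set.not_nonempty_iff_eq_empty.1 hne, Real.sSup_empty] at hs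
    linarith
  obtain ⟨r, ⟨-, -, x, hxr, hxu, hxc, hxw, hx⟩, hr⟩ := exists_lt_of_lt_csSup hne hs'
  have hxd := hxr.mono hr.le
  refine hG.not_orderIso hT (hT₁ x hxc hxd) hxd hxc hxw ?_
  have : G ∈ otp E x := hx ▸ ⟨hGu, hG.isChain hT, hM.orderIso_refl hGu⟩
  exact this.2.2

end

section

variable {M : Type*} [MetricSpace M] {E : M → M → Prop}

/-! ### Standard natural numbers have scale one -/

theorem IsMetricSetStructure.exists_equiv (hM : IsMetricSetStructure E) {a b : M} {n : ℕ}
    (ha : IsChain E a) (hb : IsChain E b) (han : (members E a).encard = n)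
    (hbn : (members E b).encard = n) :
    ∃ e : members E a ≃ members E b, ∀ x y, Sub E x.1 y.1 ↔ Sub E (e x).1 (e y).1 := by
  classical
  have key : ∀ a : M, IsChain E a → (members E a).encard = n →
      ∃ e : members E a ≃ Fin n, ∀ x y, Sub E x.1 y.1 ↔ e x ≤ e y := by
    intro a ha han
    have hfin : (members E a).Finite := Set.finite_of_encard_eq_coe han
    let := hfin.fintype
    let : LinearOrder (members E a) :=
      { le := fun x y => Sub E x.1 y.1
        le_refl := fun x z h => h
        le_trans := fun x y z h h' w hw => h' w (h w hw)
        le_antisymm := fun x y h h' => Subtype.ext (hM.ext fun z => ⟨h z, h' z⟩)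
        le_total := fun x y => ha _ _ x.2 y.2
        toDecidableLE := Classical.decRel _ }
    have hcard : Fintype.card (members E a) = n := by
      rw [← Set.toFinset_card]
      rw [Set.encard_eq_coe_toFinset_card] at han
      exact_mod_cast han
    let e := (Fintype.orderIsoFinOfCardEq (members E a) hcard).symm
    exact ⟨e.toEquiv, fun x y => (e.le_iff_le (x := x) (y := y)).symm⟩
  obtain ⟨e, he⟩ := key a ha han
  obtain ⟨e', he'⟩ := key b hb hbn
  exact ⟨e.trans e'.symm, fun x y => by rw [he, he']; simp⟩

theorem IsModel.orderIso_of_encard (hM : IsModel E) {a b : M} {n : ℕ}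
    (ha : IsChain E a) (hb : IsChain E b) (han : (members E a).encard = n)
    (hbn : (members E b).encard = n) : OrderIso E a b := by
  obtain ⟨e, he⟩ := hM.exists_equiv ha hb han hbn
  have hfin : (members E a).Finite := Set.finite_of_encard_eq_coe han
  have : Finite (members E a) := hfin
  obtain ⟨f, hf⟩ := hM.exists_members_eq_of_finite
    (Set.finite_range fun x : members E a => hM.pair x.1 (e x).1)
  have hf' : ∀ p, E p f ↔ ∃ x : members E a, hM.pair x.1 (e x).1 = p := Set.ext_iff.1 hf
  have hmaps : ∀ x y, Maps E f x y ↔ ∃ hx : E x a, (e ⟨x, hx⟩).1 = y := fun x y => by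
    rw [hM.maps_iff, hf']
    constructor
    · rintro ⟨z, h⟩
      obtain ⟨rfl, rfl⟩ := hM.pair_inj h
      exact ⟨z.2, rfl⟩
    · rintro ⟨hx, rfl⟩
      exact ⟨⟨x, hx⟩, rfl⟩
  refine ⟨f, ⟨fun p hp => ?_, fun x hx => ?_, fun y hy => ?_⟩, fun g h g' h' hg hh hg' hh' => ?_⟩
  · obtain ⟨x, rfl⟩ := (hf' p).1 hp
    exact ⟨_, _, x.2, (e x).2, hM.isPair_iff.2 rfl⟩
  · exact ⟨_, ⟨(e ⟨x, hx⟩).2, (hmaps _ _).2 ⟨hx, rfl⟩⟩,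
      fun y hy => ((hmaps _ _).1 hy.2).2.symm⟩
  · refine ⟨(e.symm ⟨y, hy⟩).1, ⟨(e.symm ⟨y, hy⟩).2, (hmaps _ _).2 ⟨(e.symm ⟨y, hy⟩).2, by simp⟩⟩,
      fun x hx => ?_⟩
    obtain ⟨hxa, h⟩ := (hmaps _ _).1 hx.2
    have : e ⟨x, hxa⟩ = ⟨y, hy⟩ := Subtype.ext h
    rw [← this, Equiv.symm_apply_apply]
  · obtain ⟨hga, rfl⟩ := (hmaps _ _).1 hg'
    obtain ⟨hha, rfl⟩ := (hmaps _ _).1 hh'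
    exact he ⟨g, hga⟩ ⟨h, hha⟩

omit [MetricSpace M] in
theorem OrderIso.encard_eq {a b : M} (h : OrderIso E a b) :
    (members E a).encard = (members E b).encard := by
  obtain ⟨f, ⟨-, hfun, hsurj⟩, -⟩ := h
  choose! g hg hguniq using hfun
  have hbij : Set.BijOn g (members E a) (members E b) := by
    refine ⟨fun x hx => (hg x hx).1, fun x hx x' hx' h => ?_, fun y hy => ?_⟩
    · exact (hsurj (g x) (hg x hx).1).unique ⟨hx, (hg x hx).2⟩ ⟨hx', h ▸ (hg x' hx').2⟩
    · obtain ⟨x, ⟨hx, hxy⟩, -⟩ := hsurj y hy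
      exact ⟨x, hx, (hguniq x hx y ⟨hy, hxy⟩).symm⟩
  rw [← hbij.image_eq, hbij.injOn.encard_image]

/-- Isomorphisms preserve the actual number of members, and that number determines finite chains up
to isomorphism, so no internal graphs need to be composed. -/
theorem IsModel.otp_eq_of_encard (hM : IsModel E) {a b : M} {n : ℕ}
    (ha : IsChain E a) (hb : IsChain E b) (han : (members E a).encard = n)
    (hbn : (members E b).encard = n) : otp E a = otp E b := by
  ext c
  refine and_congr_right fun _ => and_congr_right fun hc => ⟨fun h => ?_, fun h => ?_⟩
  · exact hM.orderIso_of_encard hb hc hbn (h.encard_eq ▸ han)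
  · exact hM.orderIso_of_encard ha hc han (h.encard_eq ▸ hbn)

omit [MetricSpace M] in
theorem IsChain.isWellOrdered_of_finite {a : M} (ha : IsChain E a) (hf : (members E a).Finite) :
    IsWellOrdered E a := by
  intro b hb hne
  have hbf : (members E b).Finite := hf.subset hb
  obtain ⟨m, hm, hmin⟩ := hbf.exists_minimalFor (members E) _ hne
  refine ⟨m, hm, fun x hx => (ha m x (hb m hm) (hb x hx)).elim id fun h => hmin hx h⟩

/-- The finite von Neumann ordinals of a model. -/
theorem IsModel.exists_vonNeumann (hM : IsModel E) :
    ∃ w : ℕ → M, ∀ n x, E x (w n) ↔ ∃ i < n, x = w i := by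
  let w : ℕ → M := fun n => n.rec hM.empty fun _ a => hM.ofClass (insert a (members E a))
  have hw : ∀ n, (members E (w n)).Finite ∧ ∀ x, E x (w n) ↔ ∃ i < n, x = w i := by
    intro n
    induction n with
    | zero =>
      have : ∀ x, ¬ E x (w 0) := fun x => hM.notMem_empty
      exact ⟨Set.finite_empty.subset fun x hx => (this x hx).elim, fun x => by simp [this]⟩
    | succ n ih =>
      have hmem : ∀ x, E x (w (n + 1)) ↔ x = w n ∨ E x (w n) := fun x =>
        hM.mem_ofClass (hM.exists_members_eq_of_finite (ih.1.insert (w n)))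
      refine ⟨(ih.1.insert (w n)).subset fun x hx => (hmem x).1 hx, fun x => ?_⟩
      rw [hmem, ih.2]
      constructor
      · rintro (rfl | ⟨i, hi, rfl⟩)
        · exact ⟨n, n.lt_succ_self, rfl⟩
        · exact ⟨i, hi.trans n.lt_succ_self, rfl⟩
      · rintro ⟨i, hi, rfl⟩
        rcases Nat.lt_succ_iff_lt_or_eq.1 hi with h | rfl
        · exact .inr ⟨i, h, rfl⟩
        · exact .inl rfl
  exact ⟨w, fun n => (hw n).2⟩

theorem IsModel.exists_one_discrete (hM : IsModel E) (n : ℕ) :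
    ∃ a, IsDiscrete E 1 a ∧ IsChain E a ∧ (members E a).encard = n := by
  obtain ⟨w, hw⟩ := hM.exists_vonNeumann
  -- If `w i ∈ w j` were less than 1 away from a member `w k` of `w i`, the pair k < i would
  -- contradict the induction hypothesis.
  have hdist : ∀ i j, i < j → dist (w i) (w j) = 1 := by
    intro i
    induction i using Nat.strong_induction_on with
    | _ i ih =>
      intro j hij
      refine le_antisymm (hM.dist_le_one _ _) (not_lt.1 fun h => ?_)
      rw [dist_comm] at h
      obtain ⟨y, hy, hd⟩ := hM.exists_dist_lt ((hw j _).2 ⟨i, hij, rfl⟩) h le_rfl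
      obtain ⟨k, hk, rfl⟩ := (hw i y).1 hy
      rw [dist_comm, ih k hk i hk] at hd
      exact lt_irrefl _ hd
  have hinj : Function.Injective w := by
    intro i j h
    by_contra hne
    rcases Nat.lt_or_gt_of_ne hne with h' | h'
    · simpa [h] using hdist i j h'
    · simpa [h] using hdist j i h'
  refine ⟨w n, fun b c hb hc => ?_, fun b c hb hc => ?_, ?_⟩
  · obtain ⟨i, -, rfl⟩ := (hw n b).1 hb
    obtain ⟨j, -, rfl⟩ := (hw n c).1 hc
    rcases lt_trichotomy i j with h | rfl | h
    · exact .inr (hdist i j h).ge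
    · exact .inl rfl
    · exact .inr (by rw [dist_comm]; exact (hdist j i h).ge)
  · obtain ⟨i, -, rfl⟩ := (hw n b).1 hb
    obtain ⟨j, -, rfl⟩ := (hw n c).1 hc
    have : ∀ i j, i ≤ j → Sub E (w i) (w j) := fun i j hij x hx =>
      let ⟨k, hk, h⟩ := (hw i x).1 hx
      (hw j x).2 ⟨k, hk.trans_le hij, h⟩
    exact (le_total i j).imp (this i j) (this j i)
  · have : members E (w n) = w '' (Finset.range n : Set ℕ) := by
      ext x
      refine (hw n x).trans ⟨?_, ?_⟩
      · rintro ⟨i, hi, rfl⟩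
        exact ⟨i, by simpa using hi, rfl⟩
      · rintro ⟨i, hi, rfl⟩
        exact ⟨i, by simpa using hi, rfl⟩
    rw [this, hinj.encard_image, Set.encard_coe_eq_coe_finsetCard, Finset.card_range]

theorem IsModel.one_le_scale_of_isStandardNat (hM : IsModel E) {n : ℕ} {α : Set M}
    (h : IsStandardNat E n α) : 1 ≤ scale E α := by
  obtain ⟨a, ⟨-, hac, -, rfl⟩, han⟩ := h
  obtain ⟨b, hbd, hbc, hbn⟩ := hM.exists_one_discrete n
  refine le_csSup ⟨1, fun r hr => hr.2.1⟩ ⟨one_pos, le_rfl, b, hbd, ⟨1, one_pos, hbd⟩, hbc,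
    hbc.isWellOrdered_of_finite (Set.finite_of_encard_eq_coe hbn),
    hM.otp_eq_of_encard hbc hac hbn han⟩

end

end MSE

/-! ### The main theorem. -/

theorem mainTheorem12 {M : Type*} [MetricSpace M] (E : M → M → Prop) (hM : MSE.IsModel E)
    (hfin : ∀ a : M, MSE.UniformlyDiscrete E a → ¬ MSE.IsInfinite E a) :
    (∃ α ∈ MSE.Ord E, MSE.IsFiniteOrd E α ∧ MSE.scale E α < 1) ∧
    (∀ α ∈ MSE.Ord E, MSE.scale E α < 1 → MSE.IsNonstandardNat E α) := by
  have hord : ∀ {a α}, MSE.Represents E a α → MSE.IsFiniteOrd E α := fun {a α} h =>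
    ⟨a, h, not_not.1 (hfin a h.1)⟩
  constructor
  · obtain ⟨a, ha, hs⟩ := hM.exists_scale_lt_one
    exact ⟨_, ⟨a, ha⟩, hord ha, hs⟩
  · rintro α ⟨a, ha⟩ hs
    exact ⟨hord ha, fun n hn => hs.not_ge (hM.one_le_scale_of_isStandardNat hn)⟩
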